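/- Let $n\ge 1$, let $\mathcal H=(\mathbb C^2)^{\otimes n}$, and define the $2n$ Majorana operators by $\gamma_{2j-1}=Z^{\otimes (j-1)}\otimes X\otimes \mathbb 1^{\otimes (n-j)}$ and $\gamma_{2j}=Z^{\otimes (j-1)}\otimes Y\otimes \mathbb 1^{\otimes (n-j)}$ for $1\le j\le n$. The spinor representation of $\mathrm{SO}(2n)$ is the compact group $\mathbb G_{\rm ferm}\subseteq \mathrm U(2^n)$ consisting of the unitaries $e^{\sum_{i<j}h_{ij}\gamma_i\gamma_j}$ with $h_{ij}\in\mathbb R$. Let $U$ be distributed according to the Haar probability measure of $\mathbb G_{\rm ferm}$, let $|\psi\rangle=U|0\rangle^{\otimes n}$, and denote by $\mathbb E$ the expectation over $U$. Write $X_i,Y_i,Z_i$ for the Pauli matrices acting on qubit $i$, and for a Hermitian operator $P$ write $\langle P\rangle=\langle\psi|P|\psi\rangle$. Define $$\Lambda_{\rm ent}(\psi)=\frac1n\sum_{i=1}^n\left(\langle X_i\rangle^2+\langle Y_i\rangle^2+\langle Z_i\rangle^2\right),\qquad \Lambda_{\rm uent}(\psi)=\frac1{n^2}\left(\Big\langle\sum_i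 X_i\Big\rangle^2+\Big\langle\sum_i Y_i\Big\rangle^2+\Big\langle\sum_i Z_i\Big\rangle^2\right),$$ $$\Lambda_{\rm imag}(\psi)=\frac1{2^n-1}\sum_{\substack{P\in\{\mathbb 1,X,Y,Z\}^{\otimes n}\\ P\ne\mathbb 1,\;P^T=P}}\langle P\rangle^2,\qquad \Lambda_{\rm real}(\psi)=\frac1{2^{n-1}}\sum_{\substack{P\in\{\mathbb 1,X,Y,Z\}^{\otimes n}\\ P^T=-P}}\langle P\rangle^2 .$$ Then for every $n\ge1$ $$\mathbb E[\Lambda_{\rm ent}(\psi)]=\frac1{2n-1},$$ $$\mathbb E[\Lambda_{\rm imag}(\psi)]=\frac1{2^n-1}\sum_{k=2,4,\dots,2n}\frac{\left(\binom{2n}{k}+\binom{n}{k/2}\right)\binom{n}{k/2}}{2\binom{2n}{k}},$$ $$\mathbb E[\Lambda_{\rm real}(\psi)]=\frac1{2^{n-1}}\sum_{k=2,4,\dots,2n}\frac{\left(\binom{2n}{k}-\binom{n}{k/2}\right)\binom{n}{k/2}}{2\binom{2n}{k}},$$ and for every $n\ge1$ with $n\ne2$ $$\mathbb E[\Lambda_{\rm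 uent}(\psi)]=\frac1{n(2n-1)}.$$ As $n\to\infty$, the expectations $\mathbb E[\Lambda_{\rm ent}]$, $\mathbb E[\Lambda_{\rm imag}]$, $\mathbb E[\Lambda_{\rm real}]$, $\mathbb E[\Lambda_{\rm uent}]$ converge to $0$, $\tfrac12$, $1$, $0$ respectively. -/

import Mathlib

open MeasureTheory Filter Topology

noncomputable section

namespace GaussianWitness

/-- Labels of the computational basis of `n` qubits. -/
abbrev Basis (n : ℕ) : Type := Fin n → Fin 2

/-- Operators on the `n`-qubit Hilbert space `(ℂ²)^{⊗ n}`. -/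
abbrev Op (n : ℕ) : Type := Matrix (Basis n) (Basis n) ℂ

/-- Vectors of the `n`-qubit Hilbert space `(ℂ²)^{⊗ n}`. -/
abbrev State (n : ℕ) : Type := Basis n → ℂ

/-- The one-qubit Pauli matrices, numbered `0 ↦ 1`, `1 ↦ X`, `2 ↦ Y`, `3 ↦ Z`. -/
def pauli : Fin 4 → Matrix (Fin 2) (Fin 2) ℂ :=
  ![!![1, 0; 0, 1], !![0, 1; 1, 0], !![0, -Complex.I; Complex.I, 0], !![1, 0; 0, -1]]

/-- The Pauli string `σ_{s 0} ⊗ σ_{s 1} ⊗ ⋯ ⊗ σ_{s (n-1)}`, as a Kronecker product. -/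
def pauliString {n : ℕ} (s : Fin n → Fin 4) : Op n :=
  Matrix.of fun x y => ∏ i, pauli (s i) (x i) (y i)

/-- The local Pauli operator that acts as `σ_a` on qubit `i` and trivially on the others. -/
def localPauli {n : ℕ} (a : Fin 4) (i : Fin n) : Op n :=
  pauliString (Pi.single i a)

/-- The `2n` Majorana operators (Jordan-Wigner), numbered from `0`:
`γ_{2j} = Z ⋯ Z X 1 ⋯ 1` and `γ_{2j+1} = Z ⋯ Z Y 1 ⋯ 1`, with `X` resp. `Y` on qubit `j`. -/
def majorana {n : ℕ} (k : Fin (2 * n)) : Op n :=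
  pauliString fun i : Fin n =>
    if (i : ℕ) < (k : ℕ) / 2 then 3
    else if (i : ℕ) = (k : ℕ) / 2 then (if (k : ℕ) % 2 = 0 then 1 else 2)
    else 0

/-- The unitary group `U(2^n)` of the `n`-qubit Hilbert space. -/
abbrev UGroup (n : ℕ) : Type := Matrix.unitaryGroup (Basis n) ℂ

/-- The unitaries of the form `exp (∑_{i<j} h_{ij} γ_i γ_j)` with real `h_{ij}`. (The exponent is
anti-Hermitian, so all these exponentials are unitary.) -/
def gaussianExponentials (n : ℕ) : Set (UGroup n) :=
  {U | ∃ h : Fin (2 * n) → Fin (2 * n) → ℝ,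
    (U : Op n) =
      NormedSpace.exp (∑ i, ∑ j ∈ Finset.Ioi i, (h i j : ℂ) • (majorana i * majorana j))}

/-- The group of free-fermionic (matchgate) unitaries, i.e. the spinor representation of `SO(2n)`,
as a closed subgroup of `U(2^n)`: the closed subgroup generated by the exponentials
`exp (∑_{i<j} h_{ij} γ_i γ_j)`. (These exponentials form the image of the compact connected group
`Spin(2n)`, so that neither generating a subgroup nor taking the closure adds any element.) -/
def gaussianGroup (n : ℕ) : Subgroup (UGroup n) :=
  (Subgroup.closure (gaussianExponentials n)).topologicalClosure

instance compactSpace_uGroup (n : ℕ) : CompactSpace (UGroup n) := by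
  have hK : IsCompact ((Metric.closedBall (0 : ℂ) 1).matrix : Set (Op n)) :=
    (isCompact_closedBall (0 : ℂ) 1).matrix
  have hc : IsClosed ((Matrix.unitaryGroup (Basis n) ℂ : Set (Op n))) := isClosed_unitary
  refine isCompact_iff_compactSpace.mp (hK.of_isClosed_subset hc ?_)
  intro U hU i j
  simpa using entry_norm_bound_of_unitary hU i j

instance compactSpace_gaussianGroup (n : ℕ) : CompactSpace (gaussianGroup n) :=
  isCompact_iff_compactSpace.mp
    (Subgroup.isClosed_topologicalClosure (Subgroup.closure (gaussianExponentials n))).isCompact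

/-- The Borel `σ`-algebra of the group of Gaussian unitaries. -/
instance measurableSpace_gaussianGroup (n : ℕ) : MeasurableSpace (gaussianGroup n) :=
  borel _

instance borelSpace_gaussianGroup (n : ℕ) : BorelSpace (gaussianGroup n) := ⟨rfl⟩

/-- The Haar probability measure of the group of Gaussian unitaries. -/
def gaussianHaar (n : ℕ) : Measure (gaussianGroup n) :=
  Measure.haarMeasure ⊤

instance isHaarMeasure_gaussianHaar (n : ℕ) : (gaussianHaar n).IsHaarMeasure :=
  Measure.isHaarMeasure_haarMeasure ⊤

instance isProbabilityMeasure_gaussianHaar (n : ℕ) : IsProbabilityMeasure (gaussianHaar n) :=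
  ⟨Measure.haarMeasure_self⟩

/-- The vacuum `|0⟩^{⊗ n}`. -/
def vacuum (n : ℕ) : State n := Pi.single 0 1

/-- The fermionic Gaussian state `U |0⟩^{⊗ n}`. -/
def gaussianState {n : ℕ} (U : gaussianGroup n) : State n :=
  ((U : UGroup n) : Op n).mulVec (vacuum n)

/-- The expectation value `⟨ψ|P|ψ⟩`. It is real for the Hermitian operators `P` used below. -/
def expVal {n : ℕ} (P : Op n) (ψ : State n) : ℝ :=
  (star ψ ⬝ᵥ P.mulVec ψ).re

/-- The entanglement witness
`Λ_ent(ψ) = (1/n) ∑_i (⟨X_i⟩² + ⟨Y_i⟩² + ⟨Z_i⟩²)`. -/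
def lamEnt {n : ℕ} (ψ : State n) : ℝ :=
  (1 / (n : ℝ)) * ∑ i : Fin n, ∑ a ∈ ({1, 2, 3} : Finset (Fin 4)), expVal (localPauli a i) ψ ^ 2

open Classical in
/-- The imaginarity witness: `1/(2^n-1)` times the sum of `⟨P⟩²` over the symmetric Pauli strings
`P` other than the identity. -/
def lamImag {n : ℕ} (ψ : State n) : ℝ :=
  (1 / ((2 : ℝ) ^ n - 1)) *
    ∑ s : Fin n → Fin 4 with s ≠ 0 ∧ (pauliString s).transpose = pauliString s,
      expVal (pauliString s) ψ ^ 2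

open Classical in
/-- The realness witness: `1/2^(n-1)` times the sum of `⟨P⟩²` over the antisymmetric Pauli
strings `P`. -/
def lamReal {n : ℕ} (ψ : State n) : ℝ :=
  (1 / (2 : ℝ) ^ (n - 1)) *
    ∑ s : Fin n → Fin 4 with (pauliString s).transpose = -pauliString s,
      expVal (pauliString s) ψ ^ 2

/-- The non-uniform entanglement witness
`Λ_uent(ψ) = (1/n²) (⟨∑_i X_i⟩² + ⟨∑_i Y_i⟩² + ⟨∑_i Z_i⟩²)`. -/
def lamUent {n : ℕ} (ψ : State n) : ℝ :=
  (1 / (n : ℝ) ^ 2) *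
    ∑ a ∈ ({1, 2, 3} : Finset (Fin 4)), expVal (∑ i : Fin n, localPauli a i) ψ ^ 2

/-- The expectation of `Λ(U |0⟩^{⊗ n})` for Haar-random `U` in the group of Gaussian unitaries. -/
def gaussianExpectation {n : ℕ} (Λ : State n → ℝ) : ℝ :=
  ∫ U, Λ (gaussianState U) ∂(gaussianHaar n)

end GaussianWitness

end

/-!
The average of a squared Pauli expectation value over Gaussian states follows from one conservation
law and one symmetry, both read off from the Majorana operators that a Pauli string anticommutes
with (`anticommSet`). A string is determined by this set, and every subset of the `2n` Majorana
operators occurs (`anticommEquiv`); its cardinality is the *level* of the string. Even levels are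
those of the even products of Majorana operators, and there the level is the number of factors.

*Conservation.* For every `k` the sum of `⟨P⟩²` over the strings of level `k` is the same in `ψ` and
`U ψ` for Gaussian `U` (`levelWeight_gaussianState`). Along `exp (t A)` its derivative is a
combination of the sums `∑ ⟨P⟩ ⟨[P, γ_i γ_j]⟩`, in which the terms of `P` and `P γ_i γ_j` cancel
(`sum_level_mul_commutator_pair`). In the vacuum the sum counts the strings of level `k` made of `1`
and `Z`; there are `n.choose (k / 2)` of them for even `k`, and none for odd `k`.

*Symmetry.* Conjugation by `exp (π/4 γ_i γ_j)` exchanges `i` and `j` in `anticommSet`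
(`meanSq_rotate`). By invariance of the Haar measure, `𝔼 ⟨P⟩²` depends on the level of `P` only.
Hence it is `n.choose (k / 2) / (2 * n).choose k` at even level `k`, and `0` at odd level.

The entanglement witness needs only the levels of `X_i`, `Y_i` (odd) and of `Z_i` (two). For the
non-uniform one the cross terms `𝔼 ⟨Z_i⟩ ⟨Z_j⟩` vanish, as `γ_a γ_b` with `a` on qubit `i` and `b`
on a third qubit flips the sign of `Z_i` and fixes `Z_j`. For the other two one counts the symmetric and
antisymmetric strings of a level: multiplication by `Z_j` at a qubit with `X` or `Y` exchanges the
two kinds, so that their numbers differ by that of the diagonal strings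
(`sum_level_transposeSign`). The limits use `n.choose m ^ 2 ≤ (2 * n).choose (2 * m)`.
-/

namespace GaussianWitness

variable {n : ℕ}

/-! ### Products, commutation and transposition of Pauli strings -/

/-- The label of the product of two one-qubit Pauli matrices, up to a phase. -/
def pauliMul : Fin 4 → Fin 4 → Fin 4 :=
  ![![0, 1, 2, 3], ![1, 0, 3, 2], ![2, 3, 0, 1], ![3, 2, 1, 0]]

/-- The commutation sign of two one-qubit Pauli matrices: `1` if they commute, `-1` if they
anticommute. -/
def pauliSign (a b : Fin 4) : ℤˣ := if a = 0 ∨ b = 0 ∨ a = b then 1 else -1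

/-- The transposition sign of a one-qubit Pauli matrix: `-1` for `Y`, and `1` otherwise. -/
def pauliTransposeSign (a : Fin 4) : ℤˣ := if a = 2 then -1 else 1

lemma exists_pauli_mul (a b : Fin 4) :
    ∃ c : ℂ, pauli a * pauli b = c • pauli (pauliMul a b) := by
  have h : ∀ a b : Fin 4, pauli a * pauli b = (1 : ℂ) • pauli (pauliMul a b) ∨
      pauli a * pauli b = Complex.I • pauli (pauliMul a b) ∨
      pauli a * pauli b = (-Complex.I) • pauli (pauliMul a b) := by
    intro a b
    fin_cases a <;> fin_cases b <;>
      simp [pauli, pauliMul]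
  rcases h a b with h | h | h <;> exact ⟨_, h⟩

lemma pauli_mul_comm (a b : Fin 4) :
    pauli a * pauli b = ((pauliSign a b : ℤ) : ℂ) • (pauli b * pauli a) := by
  fin_cases a <;> fin_cases b <;>
    simp [pauli, pauliSign]

lemma pauli_mul_self (a : Fin 4) : pauli a * pauli a = 1 := by
  fin_cases a <;> simp [pauli, ← Matrix.ext_iff, Fin.forall_fin_two]

lemma star_pauli_apply (a : Fin 4) (x y : Fin 2) : star (pauli a x y) = pauli a y x := by
  fin_cases a <;> fin_cases x <;> fin_cases y <;> simp [pauli]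

lemma pauli_apply_swap (a : Fin 4) (x y : Fin 2) :
    pauli a y x = ((pauliTransposeSign a : ℤ) : ℂ) * pauli a x y := by
  fin_cases a <;> fin_cases x <;> fin_cases y <;> simp [pauli, pauliTransposeSign]

lemma pauli_apply_zero_zero (a : Fin 4) : pauli a 0 0 = if a = 0 ∨ a = 3 then 1 else 0 := by
  fin_cases a <;> simp [pauli]

lemma pauliSign_pauliMul (a b c : Fin 4) :
    pauliSign (pauliMul a b) c = pauliSign a c * pauliSign b c := by
  revert a b c; decide

lemma pauliSign_comm (a b : Fin 4) : pauliSign a b = pauliSign b a := by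
  revert a b; decide

/-- The label of the product of two Pauli strings, up to a phase. -/
def strMul (s t : Fin n → Fin 4) : Fin n → Fin 4 := fun i => pauliMul (s i) (t i)

/-- The commutation sign of two Pauli strings: `1` if they commute, `-1` if they anticommute. -/
def commSign (s t : Fin n → Fin 4) : ℤˣ := ∏ i, pauliSign (s i) (t i)

/-- The transposition sign of a Pauli string: `1` if it is symmetric, `-1` if it is
antisymmetric. -/
def transposeSign (s : Fin n → Fin 4) : ℤˣ := ∏ i, pauliTransposeSign (s i)

lemma commSign_strMul_left (s t u : Fin n → Fin 4) :
    commSign (strMul s t) u = commSign s u * commSign t u := by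
  simp [commSign, strMul, pauliSign_pauliMul, Finset.prod_mul_distrib]

lemma commSign_comm (s t : Fin n → Fin 4) : commSign s t = commSign t s := by
  simp only [commSign, pauliSign_comm]

lemma commSign_strMul_right (s t u : Fin n → Fin 4) :
    commSign s (strMul t u) = commSign s t * commSign s u := by
  rw [commSign_comm, commSign_strMul_left, commSign_comm t, commSign_comm u]

lemma strMul_strMul_cancel (s t : Fin n → Fin 4) : strMul (strMul s t) t = s := by
  have h : ∀ a b : Fin 4, pauliMul (pauliMul a b) b = a := by decide
  funext i
  exact h _ _

lemma pauliString_apply (s : Fin n → Fin 4) (x y : Basis n) :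
    pauliString s x y = ∏ i, pauli (s i) (x i) (y i) := rfl

lemma pauliString_mul_apply (s t : Fin n → Fin 4) (x y : Basis n) :
    (pauliString s * pauliString t) x y = ∏ i, (pauli (s i) * pauli (t i)) (x i) (y i) := by
  simp only [Matrix.mul_apply, pauliString, Matrix.of_apply, ← Finset.prod_mul_distrib]
  exact (Fintype.prod_sum fun i b => pauli (s i) (x i) b * pauli (t i) b (y i)).symm

lemma exists_pauliString_mul (s t : Fin n → Fin 4) :
    ∃ c : ℂ, pauliString s * pauliString t = c • pauliString (strMul s t) := by
  choose c hc using exists_pauli_mul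
  refine ⟨∏ i, c (s i) (t i), ?_⟩
  ext x y
  simp [pauliString_mul_apply, hc, strMul, Finset.prod_mul_distrib, pauliString_apply]

lemma pauliString_mul_comm (s t : Fin n → Fin 4) :
    pauliString s * pauliString t =
      ((commSign s t : ℤ) : ℂ) • (pauliString t * pauliString s) := by
  ext x y
  rw [Matrix.smul_apply, pauliString_mul_apply, pauliString_mul_apply, smul_eq_mul, commSign,
    Units.coe_prod, Int.cast_prod, ← Finset.prod_mul_distrib]
  refine Finset.prod_congr rfl fun i _ => ?_
  rw [pauli_mul_comm, Matrix.smul_apply, smul_eq_mul]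

lemma pauliString_mul_self (s : Fin n → Fin 4) : pauliString s * pauliString s = 1 := by
  ext x y
  rw [pauliString_mul_apply]
  simp only [pauli_mul_self, Matrix.one_apply, funext_iff]
  by_cases h : ∀ i, x i = y i
  · simp [h]
  · rw [if_neg h]
    obtain ⟨i, hi⟩ := not_forall.mp h
    exact Finset.prod_eq_zero (Finset.mem_univ i) (if_neg hi)

lemma pauliString_conjTranspose (s : Fin n → Fin 4) :
    (pauliString s).conjTranspose = pauliString s := by
  ext x y
  simp only [Matrix.conjTranspose_apply, pauliString, Matrix.of_apply, star_prod,
    star_pauli_apply]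

lemma pauliString_transpose (s : Fin n → Fin 4) :
    (pauliString s).transpose = ((transposeSign s : ℤ) : ℂ) • pauliString s := by
  ext x y
  simp only [Matrix.transpose_apply, Matrix.smul_apply, pauliString, Matrix.of_apply,
    transposeSign, Units.coe_prod, Int.cast_prod, smul_eq_mul, ← Finset.prod_mul_distrib]
  exact Finset.prod_congr rfl fun i _ => pauli_apply_swap _ _ _

lemma pauliString_ne_neg (s : Fin n → Fin 4) : pauliString s ≠ -pauliString s := by
  intro h
  have h0 : pauliString s = 0 := by
    have h2 : (2 : ℂ) • pauliString s = 0 := by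
      rw [two_smul]
      exact add_eq_zero_iff_eq_neg.mpr h
    exact (smul_eq_zero.mp h2).resolve_left two_ne_zero
  have h1 := pauliString_mul_self s
  rw [h0, mul_zero] at h1
  exact zero_ne_one h1

lemma pauliString_transpose_eq_self_iff (s : Fin n → Fin 4) :
    (pauliString s).transpose = pauliString s ↔ transposeSign s = 1 := by
  rw [pauliString_transpose]
  rcases Int.units_eq_one_or (transposeSign s) with h | h
  · simp [h]
  · simpa [h] using (pauliString_ne_neg s).symm

lemma pauliString_transpose_eq_neg_iff (s : Fin n → Fin 4) :
    (pauliString s).transpose = -pauliString s ↔ transposeSign s = -1 := by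
  rw [pauliString_transpose]
  rcases Int.units_eq_one_or (transposeSign s) with h | h
  · simpa [h] using pauliString_ne_neg s
  · simp [h]

/-! ### Pauli strings as sets of Majorana operators -/

/-- The Pauli string of the Majorana operator `majorana k`. -/
def majoranaString (k : Fin (2 * n)) : Fin n → Fin 4 := fun i =>
  if (i : ℕ) < (k : ℕ) / 2 then 3
  else if (i : ℕ) = (k : ℕ) / 2 then (if (k : ℕ) % 2 = 0 then 1 else 2)
  else 0

lemma majorana_eq (k : Fin (2 * n)) : majorana k = pauliString (majoranaString k) := rfl

lemma commSign_majoranaString_of_lt {k l : Fin (2 * n)} (h : k < l) :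
    commSign (majoranaString k) (majoranaString l) = -1 := by
  rw [commSign, Finset.prod_eq_single (⟨(k : ℕ) / 2, by omega⟩ : Fin n)]
  · have h' : (k : ℕ) < l := h
    simp only [majoranaString]
    by_cases h2 : (k : ℕ) / 2 < (l : ℕ) / 2
    · rcases Nat.mod_two_eq_zero_or_one k with hk | hk <;> simp [h2, hk] <;> decide
    · have h3 : (k : ℕ) / 2 = (l : ℕ) / 2 := by omega
      have hk : (k : ℕ) % 2 = 0 := by omega
      have hl : (l : ℕ) % 2 = 1 := by omega
      simp [h3, hk, hl]
      decide
  · intro i _ hi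
    have h' : (k : ℕ) < l := h
    have hi' : (i : ℕ) ≠ (k : ℕ) / 2 := fun e => hi (Fin.ext e)
    simp only [majoranaString]
    rcases lt_or_gt_of_ne hi' with h2 | h2
    · rw [if_pos h2, if_pos (by omega)]
      decide
    · rw [if_neg (by omega), if_neg hi']
      simp [pauliSign]
  · simp

lemma commSign_self (s : Fin n → Fin 4) : commSign s s = 1 := by
  simp [commSign, pauliSign]

lemma commSign_majoranaString (k l : Fin (2 * n)) :
    commSign (majoranaString k) (majoranaString l) = if k = l then 1 else -1 := by
  rcases lt_trichotomy k l with h | h | h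
  · rw [commSign_majoranaString_of_lt h, if_neg h.ne]
  · rw [h, if_pos rfl, commSign_self]
  · rw [commSign_comm, commSign_majoranaString_of_lt h, if_neg h.ne']

/-- The set of (indices of) Majorana operators that anticommute with a Pauli string. For an even
string this is the set of its Majorana factors; for an odd one it is the complement of that set. -/
def anticommSet (s : Fin n → Fin 4) : Finset (Fin (2 * n)) :=
  Finset.univ.filter fun k => commSign s (majoranaString k) = -1

lemma mem_anticommSet {s : Fin n → Fin 4} {k : Fin (2 * n)} :
    k ∈ anticommSet s ↔ commSign s (majoranaString k) = -1 := by
  simp [anticommSet]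

/-- A Pauli string that commutes with all Majorana operators is trivial: if it is trivial on the
qubits below `i`, the two Majorana operators of qubit `i` see only its label at `i`. -/
lemma eq_zero_of_commSign_eq_one {s : Fin n → Fin 4}
    (h : ∀ k : Fin (2 * n), commSign s (majoranaString k) = 1) : s = 0 := by
  funext i
  induction i using WellFoundedLT.induction with
  | ind i ih =>
    have key : ∀ b : ℕ, b < 2 → pauliSign (s i) (if b = 0 then 1 else 2) = 1 := by
      intro b hb
      rw [← h ⟨2 * i + b, by omega⟩, commSign, Finset.prod_eq_single i]
      · have h1 : (2 * (i : ℕ) + b) / 2 = i := by omega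
        have h2 : (2 * (i : ℕ) + b) % 2 = b := by omega
        simp [majoranaString, h1, h2]
      · intro j _ hj
        rcases lt_or_gt_of_ne hj with h1 | h1
        · rw [ih j h1]
          simp [pauliSign]
        · have h2 : ¬ (j : ℕ) < (2 * (i : ℕ) + b) / 2 := by omega
          have h3 : ¬ (j : ℕ) = (2 * (i : ℕ) + b) / 2 := by omega
          simp [majoranaString, h2, h3, pauliSign]
      · simp
    have h0 := key 0 (by norm_num)
    have h1 := key 1 (by norm_num)
    have key' : ∀ a : Fin 4, pauliSign a 1 = 1 → pauliSign a 2 = 1 → a = 0 := by decide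
    exact key' _ h0 h1

lemma anticommSet_injective : Function.Injective (anticommSet (n := n)) := by
  intro s t h
  have h1 : strMul s t = 0 := by
    refine eq_zero_of_commSign_eq_one fun k => ?_
    have hk : k ∈ anticommSet s ↔ k ∈ anticommSet t := by rw [h]
    rw [mem_anticommSet, mem_anticommSet] at hk
    rw [commSign_strMul_left]
    rcases Int.units_eq_one_or (commSign s (majoranaString k)) with h1 | h1 <;>
      rcases Int.units_eq_one_or (commSign t (majoranaString k)) with h2 | h2 <;>
      simp [h1, h2] at hk ⊢
  have h2 : ∀ a b : Fin 4, pauliMul a b = 0 → a = b := by decide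
  funext i
  exact h2 _ _ (congrFun h1 i)

/-- Pauli strings correspond to sets of Majorana operators. -/
noncomputable def anticommEquiv (n : ℕ) : (Fin n → Fin 4) ≃ Finset (Fin (2 * n)) :=
  Equiv.ofBijective anticommSet <|
    (Fintype.bijective_iff_injective_and_card _).mpr ⟨anticommSet_injective, by
      simp [pow_mul]⟩

/-- The string of the product `s γ_i γ_j`. -/
def rotate (i j : Fin (2 * n)) (s : Fin n → Fin 4) : Fin n → Fin 4 :=
  strMul s (strMul (majoranaString i) (majoranaString j))

lemma rotate_rotate (i j : Fin (2 * n)) (s : Fin n → Fin 4) : rotate i j (rotate i j s) = s :=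
  strMul_strMul_cancel _ _

/-- Whether `s` anticommutes with `γ_i γ_j`. -/
def Flips (i j : Fin (2 * n)) (s : Fin n → Fin 4) : Prop :=
  commSign s (majoranaString i) * commSign s (majoranaString j) = -1

instance (i j : Fin (2 * n)) (s : Fin n → Fin 4) : Decidable (Flips i j s) :=
  inferInstanceAs (Decidable (_ = _))

lemma mem_anticommSet_rotate {i j : Fin (2 * n)} (hij : i ≠ j) (s : Fin n → Fin 4)
    (k : Fin (2 * n)) :
    k ∈ anticommSet (rotate i j s) ↔ ((k = i ∨ k = j) ↔ k ∉ anticommSet s) := by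
  rw [mem_anticommSet, mem_anticommSet, rotate, commSign_strMul_left, commSign_strMul_left,
    commSign_comm _ (majoranaString k), commSign_comm _ (majoranaString k),
    commSign_majoranaString, commSign_majoranaString, commSign_comm _ s]
  rcases Int.units_eq_one_or (commSign s (majoranaString k)) with h1 | h1 <;> rw [h1] <;>
    by_cases h2 : k = i <;> by_cases h3 : k = j <;>
    simp_all <;> grind

lemma flips_iff {i j : Fin (2 * n)} {s : Fin n → Fin 4} :
    Flips i j s ↔ (i ∈ anticommSet s ↔ j ∉ anticommSet s) := by
  rw [Flips, mem_anticommSet, mem_anticommSet]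
  rcases Int.units_eq_one_or (commSign s (majoranaString i)) with h1 | h1 <;>
    rcases Int.units_eq_one_or (commSign s (majoranaString j)) with h2 | h2 <;>
    simp [h1, h2]

lemma Flips.rotate {i j : Fin (2 * n)} (hij : i ≠ j) {s : Fin n → Fin 4} (h : Flips i j s) :
    Flips i j (GaussianWitness.rotate i j s) := by
  rw [flips_iff] at h ⊢
  rw [mem_anticommSet_rotate hij, mem_anticommSet_rotate hij]
  tauto

/-- If `s` anticommutes with `γ_i γ_j`, then the product `s γ_i γ_j` arises from `s` by exchanging
`i` and `j`. -/
lemma anticommSet_rotate {i j : Fin (2 * n)} (hij : i ≠ j) {s : Fin n → Fin 4}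
    (h : Flips i j s) :
    anticommSet (rotate i j s) = (anticommSet s).map (Equiv.swap i j).toEmbedding := by
  rw [flips_iff] at h
  ext k
  rw [mem_anticommSet_rotate hij, Finset.mem_map_equiv, Equiv.symm_swap]
  rcases eq_or_ne k i with rfl | hi
  · rw [Equiv.swap_apply_left]; tauto
  · rcases eq_or_ne k j with rfl | hj
    · rw [Equiv.swap_apply_right]; tauto
    · rw [Equiv.swap_apply_of_ne_of_ne hi hj]; tauto

lemma card_anticommSet_rotate {i j : Fin (2 * n)} (hij : i ≠ j) {s : Fin n → Fin 4}
    (h : Flips i j s) : (anticommSet (rotate i j s)).card = (anticommSet s).card := by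
  rw [anticommSet_rotate hij h, Finset.card_map]

/-! ### Products of two Majorana operators -/

lemma majorana_mul_self (i : Fin (2 * n)) : majorana i * majorana i = 1 :=
  pauliString_mul_self _

lemma majorana_anticomm {i j : Fin (2 * n)} (hij : i ≠ j) :
    majorana i * majorana j = -(majorana j * majorana i) := by
  rw [majorana_eq, majorana_eq, pauliString_mul_comm, commSign_majoranaString, if_neg hij]
  simp

lemma majorana_pair_sq {i j : Fin (2 * n)} (hij : i ≠ j) :
    (majorana i * majorana j) * (majorana i * majorana j) = -1 := by
  calc (majorana i * majorana j) * (majorana i * majorana j)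
      = -((majorana j * majorana i) * (majorana i * majorana j)) := by
        rw [← neg_mul, ← majorana_anticomm hij]
    _ = -(majorana j * (majorana i * majorana i) * majorana j) := by simp only [mul_assoc]
    _ = -1 := by rw [majorana_mul_self, mul_one, majorana_mul_self]

lemma star_majorana_pair {i j : Fin (2 * n)} (hij : i ≠ j) :
    star (majorana i * majorana j) = -(majorana i * majorana j) := by
  rw [star_mul, majorana_anticomm hij, neg_neg, Matrix.star_eq_conjTranspose,
    Matrix.star_eq_conjTranspose, majorana_eq, majorana_eq, pauliString_conjTranspose,
    pauliString_conjTranspose]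

lemma pauliString_mul_pair (s : Fin n → Fin 4) (i j : Fin (2 * n)) :
    pauliString s * (majorana i * majorana j) =
      ((commSign s (majoranaString i) * commSign s (majoranaString j) : ℤˣ) : ℤ) •
        ((majorana i * majorana j) * pauliString s) := by
  rw [← mul_assoc, majorana_eq, majorana_eq, pauliString_mul_comm s, smul_mul_assoc, mul_assoc,
    pauliString_mul_comm s, mul_smul_comm, smul_smul, ← Int.cast_smul_eq_zsmul ℂ, ← mul_assoc]
  push_cast
  rfl

lemma Flips.anticomm {i j : Fin (2 * n)} {s : Fin n → Fin 4} (h : Flips i j s) :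
    pauliString s * (majorana i * majorana j) = -((majorana i * majorana j) * pauliString s) := by
  rw [pauliString_mul_pair, show commSign s _ * commSign s _ = -1 from h]
  simp

lemma commute_of_not_flips {i j : Fin (2 * n)} {s : Fin n → Fin 4} (h : ¬ Flips i j s) :
    Commute (pauliString s) (majorana i * majorana j) := by
  rw [commute_iff_eq, pauliString_mul_pair, (Int.units_eq_one_or _).resolve_right h]
  simp

/-- If `s` anticommutes with `γ_i γ_j`, the product `s γ_i γ_j` is Hermitian, hence a Pauli string
up to a sign. -/
lemma Flips.exists_mul_pair {i j : Fin (2 * n)} (hij : i ≠ j) {s : Fin n → Fin 4}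
    (h : Flips i j s) :
    ∃ c : ℂ, c ^ 2 = 1 ∧
      pauliString s * (majorana i * majorana j) =
        c • pauliString (GaussianWitness.rotate i j s) := by
  obtain ⟨a, ha⟩ := exists_pauliString_mul (majoranaString i) (majoranaString j)
  obtain ⟨b, hb⟩ := exists_pauliString_mul s (strMul (majoranaString i) (majoranaString j))
  have e : pauliString s * (majorana i * majorana j) =
      (a * b) • pauliString (GaussianWitness.rotate i j s) := by
    rw [majorana_eq, majorana_eq, ha, mul_smul_comm, hb, smul_smul]
    rfl
  refine ⟨a * b, ?_, e⟩
  have h1 : (pauliString s * (majorana i * majorana j)) *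
      (pauliString s * (majorana i * majorana j)) = 1 := by
    nth_rewrite 1 [h.anticomm]
    rw [neg_mul, mul_assoc, ← mul_assoc (pauliString s) (pauliString s), pauliString_mul_self,
      one_mul, majorana_pair_sq hij, neg_neg]
  rw [e, smul_mul_smul_comm, pauliString_mul_self] at h1
  have h2 := congrFun (congrFun h1 0) 0
  simpa [pow_two] using h2

/-! ### Conservation of the Pauli weight of each level -/

/-- The Pauli strings that anticommute with exactly `k` Majorana operators. -/
def level (n k : ℕ) : Finset (Fin n → Fin 4) :=
  Finset.univ.filter fun s => (anticommSet s).card = k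

lemma mem_level {k : ℕ} {s : Fin n → Fin 4} : s ∈ level n k ↔ (anticommSet s).card = k := by
  simp [level]

/-- The exchange `s ↦ s γ_i γ_j` pairs up the strings of a level that anticommute with `γ_i γ_j`,
and the terms of a pair cancel. -/
lemma sum_level_mul_commutator_pair (F : Op n →ₗ[ℂ] ℂ) (k : ℕ) {i j : Fin (2 * n)} (hij : i ≠ j) :
    ∑ s ∈ level n k, F (pauliString s) *
      F (pauliString s * (majorana i * majorana j) -
        (majorana i * majorana j) * pauliString s) = 0 := by
  set B : Op n := majorana i * majorana j with hB
  have hcomm : ∀ s ∈ level n k, F (pauliString s) * F (pauliString s * B - B * pauliString s) ≠ 0 →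
      Flips i j s := by
    intro s _ hs
    by_contra h
    apply hs
    rw [(commute_of_not_flips h).eq, sub_self, map_zero, mul_zero]
  rw [← Finset.sum_filter_of_ne hcomm]
  have hflip : ∀ s : Fin n → Fin 4, Flips i j s →
      F (pauliString s) * F (pauliString s * B - B * pauliString s) =
        2 * (F (pauliString s) * F (pauliString s * B)) := by
    intro s hs
    have h1 : B * pauliString s = -(pauliString s * B) := by rw [hB, hs.anticomm, neg_neg]
    rw [h1, sub_neg_eq_add, map_add]
    ring
  refine self_eq_neg.mp ?_
  rw [← Finset.sum_neg_distrib]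
  refine Finset.sum_nbij' (rotate i j) (rotate i j) ?_ ?_ ?_ ?_ ?_
  · intro s hs
    rw [Finset.mem_filter, mem_level] at hs ⊢
    exact ⟨(card_anticommSet_rotate hij hs.2).trans hs.1, hs.2.rotate hij⟩
  · intro s hs
    rw [Finset.mem_filter, mem_level] at hs ⊢
    exact ⟨(card_anticommSet_rotate hij hs.2).trans hs.1, hs.2.rotate hij⟩
  · exact fun s _ => rotate_rotate i j s
  · exact fun s _ => rotate_rotate i j s
  · intro s hs
    have hs := (Finset.mem_filter.mp hs).2
    rw [hflip s hs, hflip _ (hs.rotate hij)]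
    obtain ⟨c, hc, e⟩ := hs.exists_mul_pair hij
    have e' : pauliString (rotate i j s) * B = -c • pauliString s := by
      have h1 : c • (pauliString s * B) = pauliString (rotate i j s) := by
        rw [hB, e, smul_smul, ← pow_two, hc, one_smul]
      rw [← h1, smul_mul_assoc, mul_assoc, hB, majorana_pair_sq hij, mul_neg, mul_one, smul_neg,
        neg_smul]
    rw [e', hB, e, map_smul, map_smul, smul_eq_mul, smul_eq_mul]
    ring

/-- The generator of a Gaussian unitary with real coefficients `h`. -/
noncomputable def generator (h : Fin (2 * n) → Fin (2 * n) → ℝ) : Op n :=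
  ∑ i, ∑ j ∈ Finset.Ioi i, (h i j : ℂ) • (majorana i * majorana j)

lemma sum_level_mul_commutator (F : Op n →ₗ[ℂ] ℂ) (k : ℕ) (h : Fin (2 * n) → Fin (2 * n) → ℝ) :
    ∑ s ∈ level n k, F (pauliString s) *
      F (pauliString s * generator h - generator h * pauliString s) = 0 := by
  let D : Op n →ₗ[ℂ] ℂ := ∑ s ∈ level n k, F (pauliString s) •
    F ∘ₗ (LinearMap.mulLeft ℂ (pauliString s) - LinearMap.mulRight ℂ (pauliString s))
  have hD : ∀ A : Op n, D A = ∑ s ∈ level n k, F (pauliString s) *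
      F (pauliString s * A - A * pauliString s) := by
    intro A
    simp [D]
  rw [← hD, generator, map_sum]
  refine Finset.sum_eq_zero fun i _ => ?_
  rw [map_sum]
  refine Finset.sum_eq_zero fun j hj => ?_
  rw [map_smul, hD, sum_level_mul_commutator_pair F k (Finset.mem_Ioi.mp hj).ne, smul_zero]

open scoped Matrix.Norms.Operator in
/-- Along the one-parameter group of a generator the derivative of the weight of a level is a sum
of products of expectation values with those of commutators, and this sum vanishes. -/
lemma sum_level_conj_exp (F : Op n →ₗ[ℂ] ℂ) (k : ℕ) (h : Fin (2 * n) → Fin (2 * n) → ℝ) :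
    ∑ s ∈ level n k, F (NormedSpace.exp (-generator h) * pauliString s *
      NormedSpace.exp (generator h)) ^ 2 = ∑ s ∈ level n k, F (pauliString s) ^ 2 := by
  set A : Op n := generator h with hA
  let E : ℂ → Op n := fun t => NormedSpace.exp (t • A)
  let E' : ℂ → Op n := fun t => NormedSpace.exp (t • (-A))
  let g : ℂ → ℂ := fun t => ∑ s ∈ level n k, F (E' t * pauliString s * E t) ^ 2
  have hE : ∀ t, HasDerivAt E (A * E t) t := fun t => hasDerivAt_exp_smul_const' A t
  have hE' : ∀ t, HasDerivAt E' (E' t * -A) t := fun t => hasDerivAt_exp_smul_const (-A) t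
  have hF : ∀ (P : Op n) (t : ℂ), HasDerivAt (fun t => F (E' t * P * E t))
      (F (E' t * (P * A - A * P) * E t)) t := by
    intro P t
    have h1 := ((hE' t).mul_const P).mul (hE t)
    have h2 := (LinearMap.toContinuousLinearMap F).hasFDerivAt.comp_hasDerivAt t h1
    refine h2.congr_deriv ?_
    change F _ = F _
    congr 1
    noncomm_ring
  have hg : ∀ t, HasDerivAt g 0 t := by
    intro t
    have h1 : HasDerivAt g (∑ s ∈ level n k, 2 * (F (E' t * pauliString s * E t) *
        F (E' t * (pauliString s * A - A * pauliString s) * E t))) t := by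
      refine HasDerivAt.fun_sum fun s _ => ?_
      refine ((hF (pauliString s) t).fun_pow 2).congr_deriv ?_
      norm_num
      ring
    let G : Op n →ₗ[ℂ] ℂ := F ∘ₗ LinearMap.mulRight ℂ (E t) ∘ₗ LinearMap.mulLeft ℂ (E' t)
    have h2 := sum_level_mul_commutator G k h
    refine h1.congr_deriv ?_
    rw [← Finset.mul_sum]
    refine mul_eq_zero_of_right 2 (Eq.trans ?_ h2)
    simp [G, hA]
  have hc := is_const_of_deriv_eq_zero (fun t => (hg t).differentiableAt) (fun t => (hg t).deriv)
    1 0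
  simpa [g, E, E'] using hc

/-- The expectation value in the state `ψ`, as a complex linear functional. -/
noncomputable def evalFunctional (ψ : State n) : Op n →ₗ[ℂ] ℂ where
  toFun X := star ψ ⬝ᵥ X.mulVec ψ
  map_add' X Y := by rw [Matrix.add_mulVec, dotProduct_add]
  map_smul' c X := by rw [Matrix.smul_mulVec, dotProduct_smul, RingHom.id_apply]

lemma expVal_eq (P : Op n) (ψ : State n) : expVal P ψ = (evalFunctional ψ P).re := rfl

lemma evalFunctional_pauliString (s : Fin n → Fin 4) (ψ : State n) :
    evalFunctional ψ (pauliString s) = (expVal (pauliString s) ψ : ℂ) := by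
  have h : (pauliString s).IsHermitian := pauliString_conjTranspose s
  refine Complex.ext rfl ?_
  rw [Complex.ofReal_im]
  exact h.im_star_dotProduct_mulVec_self ψ

lemma evalFunctional_mulVec (V X : Op n) (ψ : State n) :
    evalFunctional (V.mulVec ψ) X = evalFunctional ψ (star V * X * V) := by
  change star (V.mulVec ψ) ⬝ᵥ X.mulVec (V.mulVec ψ) = star ψ ⬝ᵥ (star V * X * V).mulVec ψ
  rw [Matrix.star_mulVec, ← Matrix.dotProduct_mulVec, Matrix.mulVec_mulVec, Matrix.mulVec_mulVec,
    Matrix.star_eq_conjTranspose, mul_assoc]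

lemma expVal_mulVec (V X : Op n) (ψ : State n) :
    expVal X (V.mulVec ψ) = expVal (star V * X * V) ψ := by
  rw [expVal_eq, expVal_eq, evalFunctional_mulVec]

/-- The sum of the squared expectation values of the Pauli strings of a level. -/
noncomputable def levelWeight (k : ℕ) (ψ : State n) : ℝ :=
  ∑ s ∈ level n k, expVal (pauliString s) ψ ^ 2

lemma levelWeight_cast (k : ℕ) (ψ : State n) :
    (levelWeight k ψ : ℂ) = ∑ s ∈ level n k, evalFunctional ψ (pauliString s) ^ 2 := by
  simp [levelWeight, evalFunctional_pauliString]

lemma star_eq_exp_neg {U : UGroup n} {A : Op n} (h : (U : Op n) = NormedSpace.exp A) :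
    star (U : Op n) = NormedSpace.exp (-A) := by
  have h1 : star (U : Op n) * (U : Op n) = 1 := Unitary.coe_star_mul_self U
  have h2 : (U : Op n) * NormedSpace.exp (-A) = 1 := by
    rw [h, ← Matrix.exp_add_of_commute _ _ (Commute.refl A).neg_right, add_neg_cancel,
      NormedSpace.exp_zero]
  exact left_inv_eq_right_inv h1 h2

lemma levelWeight_mulVec_of_mem_gaussianExponentials {U : UGroup n}
    (hU : U ∈ gaussianExponentials n) (k : ℕ) (ψ : State n) :
    levelWeight k ((U : Op n).mulVec ψ) = levelWeight k ψ := by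
  obtain ⟨h, hU⟩ := hU
  change (U : Op n) = NormedSpace.exp (generator h) at hU
  have h1 := sum_level_conj_exp (evalFunctional ψ) k h
  rw [← star_eq_exp_neg hU, ← hU] at h1
  simp only [← evalFunctional_mulVec] at h1
  rw [← levelWeight_cast, ← levelWeight_cast] at h1
  exact_mod_cast h1

lemma continuous_expVal (P : Op n) : Continuous (expVal P) := by
  unfold expVal
  exact Complex.continuous_re.comp
    (Continuous.dotProduct continuous_star (Continuous.matrix_mulVec continuous_const continuous_id))

lemma continuous_levelWeight (k : ℕ) : Continuous (levelWeight (n := n) k) :=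
  continuous_finsetSum _ fun _ _ => (continuous_expVal _).pow 2

/-- The subgroup of the unitaries that preserve the weight of every level. -/
def weightPreserving (n : ℕ) : Subgroup (UGroup n) where
  carrier := {U | ∀ k ψ, levelWeight k ((U : Op n).mulVec ψ) = levelWeight k ψ}
  one_mem' := by simp
  mul_mem' := by
    intro U V hU hV k ψ
    rw [Submonoid.coe_mul, ← Matrix.mulVec_mulVec, hU, hV]
  inv_mem' := by
    intro U hU k ψ
    rw [← hU k, Matrix.mulVec_mulVec, ← Submonoid.coe_mul, mul_inv_cancel, Submonoid.coe_one,
      Matrix.one_mulVec]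

lemma isClosed_weightPreserving (n : ℕ) : IsClosed (weightPreserving n : Set (UGroup n)) := by
  have h : (weightPreserving n : Set (UGroup n)) =
      ⋂ k, ⋂ ψ, {U : UGroup n | levelWeight k ((U : Op n).mulVec ψ) = levelWeight k ψ} := by
    ext U
    simp [weightPreserving]
  rw [h]
  refine isClosed_iInter fun k => isClosed_iInter fun ψ => isClosed_eq ?_ continuous_const
  exact (continuous_levelWeight k).comp
    (Continuous.matrix_mulVec continuous_subtype_val continuous_const)

lemma gaussianGroup_le_weightPreserving (n : ℕ) : gaussianGroup n ≤ weightPreserving n :=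
  Subgroup.topologicalClosure_minimal _ ((Subgroup.closure_le _).mpr fun _ hU k ψ =>
    levelWeight_mulVec_of_mem_gaussianExponentials hU k ψ) (isClosed_weightPreserving n)

lemma levelWeight_gaussianState (k : ℕ) (U : gaussianGroup n) :
    levelWeight k (gaussianState U) = levelWeight k (vacuum n) :=
  gaussianGroup_le_weightPreserving n U.2 k _

/-! ### Haar averages of Pauli expectation values -/

open scoped Matrix.Norms.Operator in
/-- As `B = γ_i γ_j` satisfies `B² = -1`, it generates a copy of the complex numbers, in which
Euler's formula holds. -/
lemma exp_smul_pair {i j : Fin (2 * n)} (hij : i ≠ j) (t : ℝ) :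
    NormedSpace.exp ((t : ℂ) • (majorana i * majorana j) : Op n) =
      (Real.cos t : ℂ) • (1 : Op n) + (Real.sin t : ℂ) • (majorana i * majorana j) := by
  let f : ℂ →ₐ[ℝ] Op n := Complex.lift ⟨majorana i * majorana j, majorana_pair_sq hij⟩
  have hf : ∀ z : ℂ, f z = (z.re : ℂ) • (1 : Op n) + (z.im : ℂ) • (majorana i * majorana j) := by
    intro z
    simp [f, Complex.liftAux_apply, Algebra.algebraMap_eq_smul_one]
  have hc : Continuous f := f.toLinearMap.continuous_of_finiteDimensional
  have h1 := NormedSpace.map_exp f hc (t * Complex.I)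
  rw [← Complex.exp_eq_exp_ℂ, hf, hf] at h1
  rw [Complex.exp_ofReal_mul_I_re, Complex.exp_ofReal_mul_I_im] at h1
  have h2 : (((t * Complex.I : ℂ).re : ℂ) • (1 : Op n) +
      ((t * Complex.I : ℂ).im : ℂ) • (majorana i * majorana j)) =
      (t : ℂ) • (majorana i * majorana j) := by
    simp
  rw [h2] at h1
  exact h1.symm

lemma exists_gaussian_exp_pair {i j : Fin (2 * n)} (hij : i < j) (t : ℝ) :
    ∃ V : gaussianGroup n, ((V : UGroup n) : Op n) =
      (Real.cos t : ℂ) • (1 : Op n) + (Real.sin t : ℂ) • (majorana i * majorana j) := by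
  have hskew : star ((t : ℂ) • (majorana i * majorana j) : Op n) =
      -((t : ℂ) • (majorana i * majorana j)) := by
    rw [star_smul, star_majorana_pair hij.ne, smul_neg]
    simp
  have hunit : NormedSpace.exp ((t : ℂ) • (majorana i * majorana j) : Op n) ∈
      Matrix.unitaryGroup (Basis n) ℂ := by
    rw [Matrix.mem_unitaryGroup_iff, Matrix.star_eq_conjTranspose, ← Matrix.exp_conjTranspose,
      ← Matrix.star_eq_conjTranspose, hskew,
      ← Matrix.exp_add_of_commute _ _ ((Commute.refl (_ : Op n)).neg_right), add_neg_cancel,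
      NormedSpace.exp_zero]
  let V : UGroup n := ⟨_, hunit⟩
  have hV : V ∈ gaussianExponentials n := by
    refine ⟨fun a b => if a = i ∧ b = j then t else 0, ?_⟩
    change NormedSpace.exp _ = NormedSpace.exp _
    congr 1
    rw [Finset.sum_eq_single i, Finset.sum_eq_single j]
    · simp
    · intro b _ hb
      simp [hb]
    · simp [hij]
    · intro a _ ha
      simp [ha]
    · simp
  exact ⟨⟨V, Subgroup.le_topologicalClosure _ (Subgroup.subset_closure hV)⟩,
    exp_smul_pair hij.ne t⟩

lemma continuous_gaussianState (n : ℕ) : Continuous (gaussianState (n := n)) :=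
  Continuous.matrix_mulVec (continuous_subtype_val.comp continuous_subtype_val) continuous_const

lemma integrable_gaussianState {f : State n → ℝ} (hf : Continuous f) :
    Integrable (fun U => f (gaussianState U)) (gaussianHaar n) :=
  (hf.comp (continuous_gaussianState n)).integrable_of_hasCompactSupport
    (HasCompactSupport.of_compactSpace _)

lemma gaussianState_mul (V U : gaussianGroup n) :
    gaussianState (V * U) = ((V : UGroup n) : Op n).mulVec (gaussianState U) := by
  simp [gaussianState, Matrix.mulVec_mulVec]

lemma gaussianExpectation_mulVec (V : gaussianGroup n) (f : State n → ℝ) :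
    gaussianExpectation (fun ψ => f (((V : UGroup n) : Op n).mulVec ψ)) =
      gaussianExpectation f := by
  simp only [gaussianExpectation, ← gaussianState_mul]
  exact integral_mul_left_eq_self (fun U => f (gaussianState U)) V

/-- The Haar average of the squared expectation value of a Pauli string. -/
noncomputable def meanSq (s : Fin n → Fin 4) : ℝ :=
  gaussianExpectation fun ψ => expVal (pauliString s) ψ ^ 2

/-- The rotation by `exp (π/4 γ_i γ_j)` sends `s` to `s γ_i γ_j`, up to a sign. -/
lemma meanSq_rotate {i j : Fin (2 * n)} (hij : i < j) {s : Fin n → Fin 4} (h : Flips i j s) :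
    meanSq (rotate i j s) = meanSq s := by
  obtain ⟨V, hV⟩ := exists_gaussian_exp_pair hij (Real.pi / 4)
  obtain ⟨c, hc, e⟩ := h.exists_mul_pair hij.ne
  rw [meanSq, meanSq, ← gaussianExpectation_mulVec V fun ψ => expVal (pauliString s) ψ ^ 2]
  congr 1
  funext ψ
  have h1 : star ((V : UGroup n) : Op n) * pauliString s * ((V : UGroup n) : Op n) =
      c • pauliString (rotate i j s) := by
    rw [← e, hV, Real.cos_pi_div_four, Real.sin_pi_div_four, ← smul_add, star_smul, star_add,
      star_one, star_majorana_pair hij.ne]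
    set B : Op n := majorana i * majorana j with hB
    have hBB : B * B = -1 := majorana_pair_sq hij.ne
    have hPB : B * pauliString s = -(pauliString s * B) := by rw [h.anticomm, neg_neg]
    have h2 : (1 + -B) * pauliString s * (1 + B) = (2 : ℂ) • (pauliString s * B) := by
      have : (1 + -B) * pauliString s * (1 + B) =
          pauliString s + pauliString s * B - B * pauliString s - B * pauliString s * B := by
        noncomm_ring
      rw [this, hPB, neg_mul, mul_assoc, hBB, two_smul]
      noncomm_ring
    have h3 : ((√2 / 2 : ℝ) : ℂ) * ((√2 / 2 : ℝ) : ℂ) * 2 = 1 := by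
      rw [← Complex.ofReal_mul]
      have : √2 / 2 * (√2 / 2) = (1 / 2 : ℝ) := by
        have := Real.mul_self_sqrt (show (0 : ℝ) ≤ 2 by norm_num)
        linarith
      rw [this]
      norm_num
    rw [smul_mul_assoc, smul_mul_assoc, mul_smul_comm, h2, smul_smul, smul_smul]
    simp only [Complex.star_def, Complex.conj_ofReal]
    rw [← mul_assoc, h3, one_smul]
  have h4 : (expVal (pauliString s) (((V : UGroup n) : Op n).mulVec ψ) : ℂ) =
      c * (expVal (pauliString (rotate i j s)) ψ : ℂ) := by
    rw [← evalFunctional_pauliString, ← evalFunctional_pauliString, evalFunctional_mulVec, h1,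
      map_smul, smul_eq_mul]
  have h5 : ((expVal (pauliString (rotate i j s)) ψ ^ 2 : ℝ) : ℂ) =
      ((expVal (pauliString s) (((V : UGroup n) : Op n).mulVec ψ) ^ 2 : ℝ) : ℂ) := by
    rw [Complex.ofReal_pow, Complex.ofReal_pow, h4, mul_pow, hc, one_mul]
  exact_mod_cast h5

/-- Products of two expectation values average to zero if some `γ_i γ_j` anticommutes with one of
the strings and commutes with the other: then `exp (π/2 γ_i γ_j) = γ_i γ_j` changes their sign. -/
lemma gaussianExpectation_mul_eq_zero {i j : Fin (2 * n)} (hij : i < j) {s t : Fin n → Fin 4}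
    (hs : Flips i j s) (ht : ¬ Flips i j t) :
    gaussianExpectation (fun ψ => expVal (pauliString s) ψ * expVal (pauliString t) ψ) = 0 := by
  obtain ⟨V, hV⟩ := exists_gaussian_exp_pair hij (Real.pi / 2)
  simp only [Real.cos_pi_div_two, Real.sin_pi_div_two, Complex.ofReal_zero, zero_smul, zero_add,
    Complex.ofReal_one, one_smul] at hV
  have hBB := majorana_pair_sq hij.ne
  have h1 : ∀ ψ, expVal (pauliString s) (((V : UGroup n) : Op n).mulVec ψ) =
      -expVal (pauliString s) ψ := by
    intro ψ
    rw [expVal_mulVec, hV, star_majorana_pair hij.ne, neg_mul, ← hs.anticomm, mul_assoc, hBB,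
      mul_neg, mul_one, expVal_eq, map_neg, Complex.neg_re, ← expVal_eq]
  have h2 : ∀ ψ, expVal (pauliString t) (((V : UGroup n) : Op n).mulVec ψ) =
      expVal (pauliString t) ψ := by
    intro ψ
    rw [expVal_mulVec, hV, star_majorana_pair hij.ne, neg_mul, neg_mul,
      ← (commute_of_not_flips ht).eq, mul_assoc, hBB, mul_neg, mul_one, neg_neg]
  refine self_eq_neg.mp ?_
  nth_rewrite 1 [← gaussianExpectation_mulVec V]
  simp only [h1, h2, gaussianExpectation, neg_mul]
  exact integral_neg _

lemma meanSq_symm_map (σ : Equiv.Perm (Fin (2 * n))) (C : Finset (Fin (2 * n))) :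
    meanSq ((anticommEquiv n).symm (C.map σ.toEmbedding)) =
      meanSq ((anticommEquiv n).symm C) := by
  induction σ using Equiv.Perm.swap_induction_on generalizing C with
  | one =>
    congr 2
    exact Finset.map_refl
  | swap_mul τ i j hij ih =>
    have key : ∀ (i j : Fin (2 * n)), i < j → ∀ C : Finset (Fin (2 * n)),
        meanSq ((anticommEquiv n).symm (C.map (Equiv.swap i j).toEmbedding)) =
          meanSq ((anticommEquiv n).symm C) := by
      intro i j hij C
      obtain ⟨s, rfl⟩ := (anticommEquiv n).surjective C
      change meanSq ((anticommEquiv n).symm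
        ((anticommSet s).map (Equiv.swap i j).toEmbedding)) = _
      by_cases h : Flips i j s
      · rw [← anticommSet_rotate hij.ne h, Equiv.symm_apply_apply, ← meanSq_rotate hij h]
        congr 1
        exact (anticommEquiv n).symm_apply_apply _
      · congr 2
        rw [flips_iff] at h
        ext k
        change _ ↔ k ∈ anticommSet s
        rw [Finset.mem_map_equiv, Equiv.symm_swap]
        rcases eq_or_ne k i with rfl | hi
        · rw [Equiv.swap_apply_left]; tauto
        · rcases eq_or_ne k j with rfl | hj
          · rw [Equiv.swap_apply_right]; tauto
          · rw [Equiv.swap_apply_of_ne_of_ne hi hj]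
    have e : C.map (Equiv.swap i j * τ).toEmbedding =
        (C.map τ.toEmbedding).map (Equiv.swap i j).toEmbedding := by
      rw [Finset.map_map]
      rfl
    rw [e, ← ih C]
    rcases lt_or_gt_of_ne hij with h | h
    · exact key i j h _
    · rw [Equiv.swap_comm]
      exact key j i h _

lemma meanSq_eq_of_card_eq {s t : Fin n → Fin 4}
    (h : (anticommSet s).card = (anticommSet t).card) : meanSq s = meanSq t := by
  let e := Finset.equivOfCardEq h
  let σ : Equiv.Perm (Fin (2 * n)) := e.extendSubtype
  have hσ : (anticommSet s).map σ.toEmbedding = anticommSet t := by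
    refine Finset.eq_of_subset_of_card_le (fun k hk => ?_) (by rw [Finset.card_map, h])
    obtain ⟨l, hl, rfl⟩ := Finset.mem_map.mp hk
    exact e.extendSubtype_mem l hl
  have h1 := meanSq_symm_map σ (anticommSet s)
  rw [hσ] at h1
  rw [← (anticommEquiv n).symm_apply_apply s, ← (anticommEquiv n).symm_apply_apply t]
  exact h1.symm

/-! ### Counting the strings of a level -/

/-- The first Majorana operator of a qubit. -/
def evenMode (j : Fin n) : Fin (2 * n) := ⟨2 * j, by omega⟩

/-- The second Majorana operator of a qubit. -/
def oddMode (j : Fin n) : Fin (2 * n) := ⟨2 * j + 1, by omega⟩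

lemma evenMode_lt_oddMode (j : Fin n) : evenMode j < oddMode j := by
  simp [evenMode, oddMode, Fin.lt_def]

@[to_additive]
lemma prod_modes {M : Type*} [CommMonoid M] (f : Fin (2 * n) → M) :
    ∏ k, f k = ∏ j, f (evenMode j) * f (oddMode j) := by
  rw [← Equiv.prod_comp (finProdFinEquiv.trans (finCongr (mul_comm n 2))) f,
    Fintype.prod_prod_type]
  refine Finset.prod_congr rfl fun j _ => ?_
  rw [Fin.prod_univ_two]
  congr 2 <;> ext <;> simp [evenMode, oddMode, add_comm]

lemma majoranaString_evenMode (j i : Fin n) :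
    majoranaString (evenMode j) i = if i < j then 3 else if i = j then 1 else 0 := by
  simp [majoranaString, evenMode, Fin.ext_iff]

lemma majoranaString_oddMode (j i : Fin n) :
    majoranaString (oddMode j) i = if i < j then 3 else if i = j then 2 else 0 := by
  have h1 : (2 * (j : ℕ) + 1) / 2 = j := by omega
  have h2 : (2 * (j : ℕ) + 1) % 2 = 1 := by omega
  simp [majoranaString, oddMode, Fin.ext_iff, h1, h2]

lemma strMul_modes (j : Fin n) :
    strMul (majoranaString (evenMode j)) (majoranaString (oddMode j)) = Pi.single j 3 := by
  funext i
  rw [strMul, majoranaString_evenMode, majoranaString_oddMode]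
  rcases lt_trichotomy i j with h | rfl | h
  · simp [h, h.ne, pauliMul]
  · simp [pauliMul]
  · simp [h.not_gt, h.ne', pauliMul]

lemma commSign_single (s : Fin n → Fin 4) (j : Fin n) (a : Fin 4) :
    commSign s (Pi.single j a) = pauliSign (s j) a := by
  rw [commSign, Finset.prod_eq_single j]
  · simp
  · intro i _ hi
    simp [hi, pauliSign]
  · simp

lemma commSign_modes (s : Fin n → Fin 4) (j : Fin n) :
    commSign s (majoranaString (evenMode j)) * commSign s (majoranaString (oddMode j)) =
      pauliSign (s j) 3 := by
  rw [← commSign_strMul_right, strMul_modes, commSign_single]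

/-- The qubits on which a Pauli string acts as `X` or `Y`. -/
def flipSites (s : Fin n → Fin 4) : Finset (Fin n) :=
  Finset.univ.filter fun j => pauliSign (s j) 3 = -1

lemma mem_flipSites {s : Fin n → Fin 4} {j : Fin n} :
    j ∈ flipSites s ↔ pauliSign (s j) 3 = -1 := by
  simp [flipSites]

lemma flips_modes_iff {s : Fin n → Fin 4} {j : Fin n} :
    Flips (evenMode j) (oddMode j) s ↔ j ∈ flipSites s := by
  rw [Flips, commSign_modes, mem_flipSites]

lemma rotate_modes (s : Fin n → Fin 4) (j : Fin n) :
    rotate (evenMode j) (oddMode j) s = strMul s (Pi.single j 3) := by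
  rw [rotate, strMul_modes]

lemma flipSites_rotate_modes (s : Fin n → Fin 4) (j : Fin n) :
    flipSites (rotate (evenMode j) (oddMode j) s) = flipSites s := by
  ext i
  rw [mem_flipSites, mem_flipSites, rotate_modes, strMul, pauliSign_pauliMul]
  rcases eq_or_ne i j with rfl | h
  · simp [pauliSign]
  · simp [h, pauliSign]

/-- Multiplying by `Z_j` exchanges `X` and `Y` on qubit `j`. -/
lemma transposeSign_rotate_modes {s : Fin n → Fin 4} {j : Fin n} (h : j ∈ flipSites s) :
    transposeSign (rotate (evenMode j) (oddMode j) s) = -transposeSign s := by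
  have h1 : ∀ a : Fin 4, pauliSign a 3 = -1 →
      pauliTransposeSign (pauliMul a 3) = -pauliTransposeSign a := by decide
  have h2 : ∀ a : Fin 4, pauliMul a 0 = a := by decide
  rw [rotate_modes, transposeSign, transposeSign, ← Finset.mul_prod_erase _ _ (Finset.mem_univ j),
    ← Finset.mul_prod_erase _ (fun i => pauliTransposeSign (s i)) (Finset.mem_univ j), ← neg_mul]
  congr 1
  · rw [strMul, Pi.single_eq_same, h1 _ (mem_flipSites.mp h)]
  · refine Finset.prod_congr rfl fun i hi => ?_
    rw [strMul, Pi.single_eq_of_ne (Finset.ne_of_mem_erase hi), h2]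

/-- The diagonal Pauli strings, i.e. those made of `1` and `Z`, of a level. -/
def diagLevel (n k : ℕ) : Finset (Fin n → Fin 4) :=
  (level n k).filter fun s => flipSites s = ∅

lemma eq_zero_or_three {s : Fin n → Fin 4} (h : flipSites s = ∅) (j : Fin n) :
    s j = 0 ∨ s j = 3 := by
  have h1 : ∀ a : Fin 4, ¬ pauliSign a 3 = -1 → a = 0 ∨ a = 3 := by decide
  refine h1 _ fun h2 => ?_
  rw [← mem_flipSites, h] at h2
  exact absurd h2 (Finset.notMem_empty j)

lemma transposeSign_eq_one_of_flipSites_eq_empty {s : Fin n → Fin 4} (h : flipSites s = ∅) :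
    transposeSign s = 1 := by
  refine Finset.prod_eq_one fun j _ => ?_
  rcases eq_zero_or_three h j with h | h <;> rw [h] <;> rfl

/-- Exchanging `X` and `Y` on a qubit keeps the level and changes the transposition sign, so only
the diagonal strings contribute to the signed count of a level. -/
lemma sum_level_transposeSign (k : ℕ) :
    ∑ s ∈ level n k, (transposeSign s : ℤ) = (diagLevel n k).card := by
  rw [← Finset.sum_fiberwise (level n k) flipSites, Finset.sum_eq_single ∅]
  · rw [Finset.sum_congr rfl (g := fun _ => (1 : ℤ))]
    · simp [diagLevel]
    · intro s hs
      rw [transposeSign_eq_one_of_flipSites_eq_empty (Finset.mem_filter.mp hs).2, Units.val_one]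
  · intro T _ hT
    obtain ⟨j, hj⟩ := Finset.nonempty_iff_ne_empty.mpr hT
    have hmem : ∀ s ∈ (level n k).filter fun s => flipSites s = T,
        rotate (evenMode j) (oddMode j) s ∈ (level n k).filter fun s => flipSites s = T := by
      intro s hs
      rw [Finset.mem_filter, mem_level] at hs ⊢
      rw [flipSites_rotate_modes, card_anticommSet_rotate (evenMode_lt_oddMode j).ne
        (flips_modes_iff.mpr (hs.2 ▸ hj))]
      exact hs
    refine self_eq_neg.mp ?_
    rw [← Finset.sum_neg_distrib]
    refine Finset.sum_nbij' _ _ hmem hmem (fun s _ => rotate_rotate _ _ s)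
      (fun s _ => rotate_rotate _ _ s) fun s hs => ?_
    rw [transposeSign_rotate_modes ((Finset.mem_filter.mp hs).2 ▸ hj), Units.val_neg, neg_neg]
  · simp

lemma card_level (n k : ℕ) : (level n k).card = (2 * n).choose k := by
  have h : (Finset.powersetCard k (Finset.univ : Finset (Fin (2 * n)))).card =
      (2 * n).choose k := by
    rw [Finset.card_powersetCard, Finset.card_univ, Fintype.card_fin]
  rw [← h]
  refine Finset.card_equiv (anticommEquiv n) fun s => ?_
  rw [mem_level, Finset.mem_powersetCard_univ]
  rfl

lemma card_level_transposeSign (k : ℕ) :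
    (((level n k).filter fun s => transposeSign s = 1).card : ℝ) =
        (((2 * n).choose k : ℝ) + ((diagLevel n k).card : ℝ)) / 2 ∧
      (((level n k).filter fun s => transposeSign s = -1).card : ℝ) =
        (((2 * n).choose k : ℝ) - ((diagLevel n k).card : ℝ)) / 2 := by
  have hneg : ((level n k).filter fun s => ¬ transposeSign s = 1) =
      (level n k).filter fun s => transposeSign s = -1 :=
    Finset.filter_congr fun s _ =>
      ⟨fun h => (Int.units_eq_one_or _).resolve_left h, fun h h' => by
        rw [h] at h'
        exact absurd h' (by decide)⟩
  have h1 := Finset.card_filter_add_card_filter_not (s := level n k) (fun s => transposeSign s = 1)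
  rw [hneg, card_level] at h1
  have h2 := sum_level_transposeSign (n := n) k
  rw [← Finset.sum_filter_add_sum_filter_not (level n k) (fun s => transposeSign s = 1), hneg,
    Finset.sum_congr rfl (g := fun _ => (1 : ℤ)),
    Finset.sum_congr (s₁ := (level n k).filter fun s => transposeSign s = -1) rfl
      (g := fun _ => (-1 : ℤ))] at h2
  · simp only [Finset.sum_const, nsmul_eq_mul, mul_one, mul_neg] at h2
    have h1' : (((level n k).filter fun s => transposeSign s = 1).card : ℝ) +
        (((level n k).filter fun s => transposeSign s = -1).card : ℝ) =
        ((2 * n).choose k : ℝ) := by exact_mod_cast h1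
    have h2' : (((level n k).filter fun s => transposeSign s = 1).card : ℝ) +
        -(((level n k).filter fun s => transposeSign s = -1).card : ℝ) =
        ((diagLevel n k).card : ℝ) := by exact_mod_cast h2
    constructor <;> linarith
  · intro s hs
    rw [(Finset.mem_filter.mp hs).2]
    rfl
  · intro s hs
    rw [(Finset.mem_filter.mp hs).2]
    rfl

lemma card_anticommSet_eq_sum (s : Fin n → Fin 4) :
    (anticommSet s).card = ∑ j : Fin n,
      ((if commSign s (majoranaString (evenMode j)) = -1 then 1 else 0) +
        (if commSign s (majoranaString (oddMode j)) = -1 then 1 else 0)) := by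
  rw [anticommSet, Finset.card_filter, sum_modes]

/-- The diagonal Pauli string with `Z` on the qubits of `T`. -/
def diagString (T : Finset (Fin n)) : Fin n → Fin 4 := fun i => if i ∈ T then 3 else 0

lemma flipSites_diagString (T : Finset (Fin n)) : flipSites (diagString T) = ∅ := by
  ext j
  by_cases h : j ∈ T <;> simp [mem_flipSites, diagString, h, pauliSign]

lemma commSign_diagString (T : Finset (Fin n)) (j : Fin n) :
    commSign (diagString T) (majoranaString (evenMode j)) = if j ∈ T then -1 else 1 := by
  rw [commSign, Finset.prod_eq_single j]
  · by_cases h : j ∈ T <;> simp [majoranaString_evenMode, diagString, h, pauliSign]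
  · intro i _ hi
    by_cases h : i ∈ T <;> by_cases h' : i < j <;>
      simp [majoranaString_evenMode, diagString, h, h', hi, pauliSign]
  · simp

lemma card_anticommSet_diagString (T : Finset (Fin n)) :
    (anticommSet (diagString T)).card = 2 * T.card := by
  have h : ∀ j : Fin n,
      commSign (diagString T) (majoranaString (oddMode j)) = if j ∈ T then -1 else 1 := by
    intro j
    have h1 := commSign_modes (diagString T) j
    have h2 : pauliSign (diagString T j) 3 = 1 := by
      by_cases h : j ∈ T <;> simp [diagString, h, pauliSign]
    rw [h2, commSign_diagString] at h1
    rw [← inv_eq_of_mul_eq_one_right h1]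
    split_ifs <;> simp
  rw [card_anticommSet_eq_sum]
  simp only [commSign_diagString, h]
  rw [Finset.sum_congr rfl (g := fun j => if j ∈ T then 2 else 0)]
  · rw [Finset.sum_ite_mem, Finset.univ_inter, Finset.sum_const, smul_eq_mul, mul_comm]
  · intro j _
    by_cases h : j ∈ T <;> simp [h]

lemma exists_eq_diagString {s : Fin n → Fin 4} (h : flipSites s = ∅) : ∃ T, s = diagString T := by
  refine ⟨Finset.univ.filter fun j => s j = 3, ?_⟩
  funext j
  rcases eq_zero_or_three h j with h | h <;> simp [diagString, h]

lemma card_diagLevel_two_mul (n m : ℕ) : (diagLevel n (2 * m)).card = n.choose m := by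
  have h : (Finset.powersetCard m (Finset.univ : Finset (Fin n))).card = n.choose m := by
    rw [Finset.card_powersetCard, Finset.card_univ, Fintype.card_fin]
  rw [← h]
  symm
  refine Finset.card_bij (fun T _ => diagString T) ?_ ?_ ?_
  · intro T hT
    rw [Finset.mem_powersetCard_univ] at hT
    rw [diagLevel, Finset.mem_filter, mem_level, card_anticommSet_diagString, hT]
    exact ⟨rfl, flipSites_diagString T⟩
  · intro T _ T' _ h
    ext j
    have h1 := congrFun h j
    by_cases h2 : j ∈ T <;> by_cases h3 : j ∈ T' <;> simp_all [diagString]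
  · intro s hs
    rw [diagLevel, Finset.mem_filter, mem_level] at hs
    obtain ⟨T, rfl⟩ := exists_eq_diagString hs.2
    rw [card_anticommSet_diagString] at hs
    exact ⟨T, Finset.mem_powersetCard_univ.mpr (by omega), rfl⟩

lemma diagLevel_eq_empty_of_odd {k : ℕ} (hk : Odd k) : diagLevel n k = ∅ := by
  refine Finset.eq_empty_of_forall_notMem fun s hs => ?_
  rw [diagLevel, Finset.mem_filter, mem_level] at hs
  obtain ⟨T, rfl⟩ := exists_eq_diagString hs.2
  rw [card_anticommSet_diagString] at hs
  rw [← hs.1] at hk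
  exact Nat.not_odd_iff_even.mpr (even_two_mul _) hk

/-- The parity of the level of a string is that of its number of `X` and `Y` factors. -/
lemma neg_one_pow_card_anticommSet (s : Fin n → Fin 4) :
    (-1 : ℤˣ) ^ (anticommSet s).card = ∏ j, pauliSign (s j) 3 := by
  have h : ∏ k : Fin (2 * n), commSign s (majoranaString k) = ∏ j, pauliSign (s j) 3 := by
    rw [prod_modes]
    exact Finset.prod_congr rfl fun j _ => commSign_modes s j
  rw [← h, anticommSet, ← Finset.prod_const, Finset.prod_filter]
  refine Finset.prod_congr rfl fun k _ => ?_
  rcases Int.units_eq_one_or (commSign s (majoranaString k)) with h | h <;> simp [h]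

/-! ### The second moments -/

lemma expVal_vacuum (s : Fin n → Fin 4) :
    expVal (pauliString s) (vacuum n) = if flipSites s = ∅ then 1 else 0 := by
  have h1 : star (vacuum n) ⬝ᵥ (pauliString s).mulVec (vacuum n) =
      ∏ i, (if s i = 0 ∨ s i = 3 then 1 else 0 : ℂ) := by
    have h2 : star (vacuum n) = Pi.single 0 1 := by
      rw [vacuum, ← Pi.single_star, star_one]
    rw [h2, vacuum, single_one_dotProduct, Matrix.mulVec_single_one, Matrix.col_apply,
      pauliString_apply]
    simp only [Pi.zero_apply, pauli_apply_zero_zero]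
  rw [expVal, h1]
  split_ifs with h
  · rw [Finset.prod_eq_one fun i _ => if_pos (eq_zero_or_three h i), Complex.one_re]
  · obtain ⟨j, hj⟩ := Finset.nonempty_iff_ne_empty.mpr h
    have h3 : ∀ a : Fin 4, pauliSign a 3 = -1 → ¬ (a = 0 ∨ a = 3) := by decide
    rw [Finset.prod_eq_zero (Finset.mem_univ j) (if_neg (h3 _ (mem_flipSites.mp hj))),
      Complex.zero_re]

lemma levelWeight_vacuum (k : ℕ) : levelWeight k (vacuum n) = (diagLevel n k).card := by
  simp [levelWeight, expVal_vacuum, diagLevel]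

lemma continuous_expVal_sq (P : Op n) : Continuous fun ψ => expVal P ψ ^ 2 :=
  (continuous_expVal P).pow 2

lemma choose_mul_meanSq (s : Fin n → Fin 4) :
    ((2 * n).choose (anticommSet s).card : ℝ) * meanSq s =
      (diagLevel n (anticommSet s).card).card := by
  have h0 : ∀ t ∈ level n (anticommSet s).card, meanSq t = meanSq s := fun t ht =>
    meanSq_eq_of_card_eq (mem_level.mp ht)
  have h1 : ∑ t ∈ level n (anticommSet s).card, meanSq t =
      gaussianExpectation (n := n) (levelWeight (anticommSet s).card) := by
    simp only [meanSq, gaussianExpectation, levelWeight]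
    rw [integral_finsetSum]
    exact fun t _ => integrable_gaussianState (f := fun ψ => expVal (pauliString t) ψ ^ 2)
      (continuous_expVal_sq _)
  rw [Finset.sum_congr rfl h0, Finset.sum_const,
    card_level, nsmul_eq_mul] at h1
  rw [h1, gaussianExpectation]
  simp only [levelWeight_gaussianState, levelWeight_vacuum, integral_const, probReal_univ,
    one_smul]

lemma meanSq_eq_of_even {s : Fin n → Fin 4} {k : ℕ} (hs : s ∈ level n k) (hk : Even k) :
    meanSq s = (n.choose (k / 2) : ℝ) / ((2 * n).choose k : ℝ) := by
  have h1 := choose_mul_meanSq s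
  rw [mem_level.mp hs] at h1
  obtain ⟨m, rfl⟩ := hk.two_dvd
  have hle : 2 * m ≤ 2 * n := by
    have := Finset.card_le_univ (anticommSet s)
    rwa [mem_level.mp hs, Fintype.card_fin] at this
  have hpos : ((2 * n).choose (2 * m) : ℝ) ≠ 0 := by
    exact_mod_cast (Nat.choose_pos hle).ne'
  rw [eq_div_iff hpos, mul_comm, h1, card_diagLevel_two_mul, Nat.mul_div_cancel_left m two_pos]

/-- Odd Pauli strings have vanishing expectation values in all Gaussian states, because the
conserved weight of an odd level vanishes in the vacuum. -/
lemma expVal_gaussianState_eq_zero_of_odd {s : Fin n → Fin 4} (hs : Odd (anticommSet s).card)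
    (U : gaussianGroup n) : expVal (pauliString s) (gaussianState U) = 0 := by
  have h1 := levelWeight_gaussianState (anticommSet s).card U
  rw [levelWeight_vacuum, diagLevel_eq_empty_of_odd hs, Finset.card_empty, Nat.cast_zero,
    levelWeight, Finset.sum_eq_zero_iff_of_nonneg fun _ _ => sq_nonneg _] at h1
  exact pow_eq_zero_iff two_ne_zero |>.mp (h1 s (mem_level.mpr rfl))

lemma meanSq_eq_zero_of_odd {s : Fin n → Fin 4} (hs : Odd (anticommSet s).card) :
    meanSq s = 0 := by
  simp [meanSq, gaussianExpectation, expVal_gaussianState_eq_zero_of_odd hs]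

lemma anticommSet_zero : anticommSet (0 : Fin n → Fin 4) = ∅ := by
  ext k
  simp [mem_anticommSet, commSign, pauliSign]

/-- A sum over nontrivial Pauli strings, sorted by levels. -/
lemma sum_meanSq (p : (Fin n → Fin 4) → Prop) [DecidablePred p] (hp : ¬ p 0) :
    ∑ s with p s, meanSq s = ∑ k ∈ (Finset.Icc 2 (2 * n)).filter Even,
      (((level n k).filter p).card : ℝ) *
        ((n.choose (k / 2) : ℝ) / ((2 * n).choose k : ℝ)) := by
  have h1 : ∀ s ∈ Finset.univ.filter p, meanSq s ≠ 0 →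
      (anticommSet s).card ∈ (Finset.Icc 2 (2 * n)).filter Even := by
    intro s hs h
    have h2 : Even (anticommSet s).card := by
      by_contra h2
      exact h (meanSq_eq_zero_of_odd (Nat.not_even_iff_odd.mp h2))
    have h3 : (anticommSet s).card ≠ 0 := by
      intro h3
      have h4 : s = 0 := anticommSet_injective
        ((Finset.card_eq_zero.mp h3).trans anticommSet_zero.symm)
      rw [h4, Finset.mem_filter] at hs
      exact hp hs.2
    have h4 := Finset.card_le_univ (anticommSet s)
    rw [Fintype.card_fin] at h4
    rw [Finset.mem_filter, Finset.mem_Icc]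
    obtain ⟨m, hm⟩ := h2
    exact ⟨⟨by omega, h4⟩, ⟨m, hm⟩⟩
  rw [← Finset.sum_filter_of_ne h1, ← Finset.sum_fiberwise_of_maps_to
    (t := (Finset.Icc 2 (2 * n)).filter Even) (g := fun s => (anticommSet s).card)
    (fun s hs => (Finset.mem_filter.mp hs).2)]
  refine Finset.sum_congr rfl fun k hk => ?_
  rw [← nsmul_eq_mul, ← Finset.sum_const]
  refine Finset.sum_congr ?_ fun s hs => ?_
  · ext s
    simp only [Finset.mem_filter, Finset.mem_univ, true_and, mem_level]
    constructor
    · rintro ⟨⟨h1, _⟩, h2⟩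
      exact ⟨h2, h1⟩
    · rintro ⟨rfl, h2⟩
      exact ⟨⟨h2, Finset.mem_filter.mp hk⟩, rfl⟩
  · exact meanSq_eq_of_even (Finset.mem_filter.mp hs).1 (Finset.mem_filter.mp hk).2

/-! ### The witnesses -/

lemma neg_one_pow_card_anticommSet_single (a : Fin 4) (i : Fin n) :
    (-1 : ℤˣ) ^ (anticommSet (Pi.single i a : Fin n → Fin 4)).card = pauliSign a 3 := by
  rw [neg_one_pow_card_anticommSet, Finset.prod_eq_single i]
  · simp
  · intro j _ hj
    simp [hj, pauliSign]
  · simp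

lemma odd_card_anticommSet_single {a : Fin 4} (ha : pauliSign a 3 = -1) (i : Fin n) :
    Odd (anticommSet (Pi.single i a : Fin n → Fin 4)).card := by
  by_contra h
  have h1 := neg_one_pow_card_anticommSet_single a i
  rw [(Nat.not_odd_iff_even.mp h).neg_one_pow, ha] at h1
  exact absurd h1 (by decide)

lemma single_three_eq_diagString (i : Fin n) : (Pi.single i 3 : Fin n → Fin 4) = diagString {i} := by
  funext j
  by_cases h : j = i
  · subst h
    simp [diagString]
  · simp [diagString, h]

lemma meanSq_single_three (i : Fin n) :
    meanSq (Pi.single i 3 : Fin n → Fin 4) = 1 / (2 * (n : ℝ) - 1) := by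
  have h1 : (Pi.single i 3 : Fin n → Fin 4) ∈ level n 2 := by
    rw [mem_level, single_three_eq_diagString, card_anticommSet_diagString,
      Finset.card_singleton]
  have hn : (1 : ℝ) ≤ n := by exact_mod_cast i.pos
  rw [meanSq_eq_of_even h1 even_two, Nat.cast_choose_two]
  have h2 : (2 * (n : ℝ) - 1) ≠ 0 := by linarith
  have h3 : (n : ℝ) ≠ 0 := by linarith
  norm_num
  field_simp

lemma gaussianExpectation_localPauli_three_sq (i : Fin n) :
    gaussianExpectation (fun ψ => expVal (localPauli 3 i) ψ ^ 2) = 1 / (2 * (n : ℝ) - 1) :=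
  meanSq_single_three i

lemma continuous_lamEnt : Continuous (lamEnt (n := n)) :=
  continuous_const.mul (continuous_finsetSum _ fun _ _ => continuous_finsetSum _ fun _ _ =>
    continuous_expVal_sq _)

lemma continuous_lamUent : Continuous (lamUent (n := n)) :=
  continuous_const.mul (continuous_finsetSum _ fun _ _ => continuous_expVal_sq _)

lemma continuous_lamImag : Continuous (lamImag (n := n)) :=
  continuous_const.mul (continuous_finsetSum _ fun _ _ => continuous_expVal_sq _)

lemma continuous_lamReal : Continuous (lamReal (n := n)) :=
  continuous_const.mul (continuous_finsetSum _ fun _ _ => continuous_expVal_sq _)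

lemma gaussianExpectation_const_mul_sum {ι : Type*} (c : ℝ) (S : Finset ι) (f : ι → State n → ℝ)
    (hf : ∀ i ∈ S, Continuous (f i)) :
    gaussianExpectation (fun ψ => c * ∑ i ∈ S, f i ψ) =
      c * ∑ i ∈ S, gaussianExpectation (f i) := by
  simp only [gaussianExpectation]
  rw [integral_const_mul, integral_finsetSum]
  exact fun i hi => integrable_gaussianState (hf i hi)

lemma expVal_localPauli_eq_zero {a : Fin 4} (ha : pauliSign a 3 = -1) (i : Fin n)
    (U : gaussianGroup n) : expVal (localPauli a i) (gaussianState U) = 0 :=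
  expVal_gaussianState_eq_zero_of_odd (odd_card_anticommSet_single ha i) U

lemma gaussianExpectation_lamEnt (hn : 1 ≤ n) :
    gaussianExpectation (n := n) lamEnt = 1 / (2 * (n : ℝ) - 1) := by
  have h1 : gaussianExpectation (n := n) lamEnt = gaussianExpectation (n := n) fun ψ =>
      (1 / (n : ℝ)) * ∑ i : Fin n, expVal (localPauli 3 i) ψ ^ 2 := by
    simp only [gaussianExpectation, lamEnt]
    congr 1
    funext U
    congr 1
    refine Finset.sum_congr rfl fun i _ => ?_
    rw [Finset.sum_insert (by decide), Finset.sum_insert (by decide), Finset.sum_singleton,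
      expVal_localPauli_eq_zero (by decide), expVal_localPauli_eq_zero (by decide)]
    ring
  rw [h1, gaussianExpectation_const_mul_sum _ _ _ fun _ _ => continuous_expVal_sq _,
    Finset.sum_congr rfl fun i _ => gaussianExpectation_localPauli_three_sq i, Finset.sum_const, Finset.card_univ,
    Fintype.card_fin, nsmul_eq_mul, ← mul_assoc,
    one_div_mul_cancel (by exact_mod_cast (by omega : n ≠ 0)), one_mul]

/-- For `n ≥ 3` there is a qubit `l` other than `i` and `j`; the product of the first Majorana
operators of `i` and `l` anticommutes with `Z_i` and commutes with `Z_j`. For `n = 2` there is no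
such product: `⟨Z_0⟩ = ⟨Z_1⟩` in every Gaussian state, and the average does not vanish. -/
lemma gaussianExpectation_cross (hn : n ≠ 2) {i j : Fin n} (hij : i ≠ j) :
    gaussianExpectation (fun ψ => expVal (localPauli 3 i) ψ * expVal (localPauli 3 j) ψ) = 0 := by
  obtain ⟨l, hl⟩ : ∃ l : Fin n, l ∉ ({i, j} : Finset (Fin n)) := by
    by_contra! h
    have h1 : (Finset.univ : Finset (Fin n)) = {i, j} :=
      (Finset.eq_univ_of_forall h).symm
    have h2 := congrArg Finset.card h1
    rw [Finset.card_univ, Fintype.card_fin, Finset.card_pair hij] at h2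
    exact hn h2
  simp only [Finset.mem_insert, Finset.mem_singleton, not_or] at hl
  have hs : ∀ a b : Fin n, evenMode a ∈ anticommSet (Pi.single b 3 : Fin n → Fin 4) ↔ a = b := by
    intro a b
    rw [mem_anticommSet, single_three_eq_diagString, commSign_diagString]
    by_cases h : a = b <;> simp [h]
  have h1 : Flips (evenMode i) (evenMode l) (Pi.single i 3) := by
    rw [flips_iff, hs, hs]
    simp [hl.1]
  have h2 : ¬ Flips (evenMode i) (evenMode l) (Pi.single j 3) := by
    rw [flips_iff, hs, hs]
    simp [hl.2, hij]
  have h1' : Flips (evenMode l) (evenMode i) (Pi.single i 3) := by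
    rw [flips_iff, hs, hs]
    simp [hl.1]
  have h2' : ¬ Flips (evenMode l) (evenMode i) (Pi.single j 3) := by
    rw [flips_iff, hs, hs]
    simp [hl.2, hij]
  have hne : evenMode i ≠ evenMode l := by
    intro h
    have := congrArg Fin.val h
    simp only [evenMode] at this
    exact hl.1 (Fin.ext (by omega))
  rcases lt_or_gt_of_ne hne with h | h
  · exact gaussianExpectation_mul_eq_zero h h1 h2
  · exact gaussianExpectation_mul_eq_zero h h1' h2'

lemma continuous_expVal_mul (P Q : Op n) : Continuous fun ψ => expVal P ψ * expVal Q ψ :=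
  (continuous_expVal P).mul (continuous_expVal Q)

lemma gaussianExpectation_lamUent (hn : 1 ≤ n) (hn2 : n ≠ 2) :
    gaussianExpectation (n := n) lamUent = 1 / ((n : ℝ) * (2 * (n : ℝ) - 1)) := by
  have hsum : ∀ (a : Fin 4) (ψ : State n), expVal (∑ i : Fin n, localPauli a i) ψ =
      ∑ i : Fin n, expVal (localPauli a i) ψ := by
    intro a ψ
    simp [expVal_eq]
  have h1 : gaussianExpectation (n := n) lamUent = gaussianExpectation (n := n) fun ψ =>
      (1 / (n : ℝ) ^ 2) * ∑ q : Fin n × Fin n,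
        expVal (localPauli 3 q.1) ψ * expVal (localPauli 3 q.2) ψ := by
    simp only [gaussianExpectation, lamUent]
    congr 1
    funext U
    congr 1
    rw [Finset.sum_insert (by decide), Finset.sum_insert (by decide), Finset.sum_singleton,
      hsum, hsum, hsum, Finset.sum_eq_zero fun i _ => expVal_localPauli_eq_zero (by decide) i U,
      Finset.sum_eq_zero fun i _ => expVal_localPauli_eq_zero (by decide) i U, pow_two (∑ i, _),
      Finset.sum_mul_sum, Fintype.sum_prod_type]
    ring
  rw [h1, gaussianExpectation_const_mul_sum _ _ _ fun q _ =>
    continuous_expVal_mul _ _, Fintype.sum_prod_type]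
  have h2 : ∀ i : Fin n, ∑ j : Fin n, gaussianExpectation (fun ψ =>
      expVal (localPauli 3 i) ψ * expVal (localPauli 3 j) ψ) = 1 / (2 * (n : ℝ) - 1) := by
    intro i
    rw [Finset.sum_eq_single i]
    · simp only [← pow_two]
      exact gaussianExpectation_localPauli_three_sq i
    · exact fun j _ hj => gaussianExpectation_cross hn2 hj.symm
    · simp
  rw [Finset.sum_congr rfl fun i _ => h2 i, Finset.sum_const, Finset.card_univ, Fintype.card_fin,
    nsmul_eq_mul]
  have hn' : (1 : ℝ) ≤ n := by exact_mod_cast hn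
  have h3 : (2 * (n : ℝ) - 1) ≠ 0 := by linarith
  have h4 : (n : ℝ) ≠ 0 := by linarith
  field_simp

lemma gaussianExpectation_lamImag :
    gaussianExpectation (n := n) lamImag = 1 / ((2 : ℝ) ^ n - 1) *
      ∑ k ∈ (Finset.Icc 2 (2 * n)).filter Even,
        (((2 * n).choose k : ℝ) + (n.choose (k / 2) : ℝ)) * (n.choose (k / 2) : ℝ) /
          (2 * ((2 * n).choose k : ℝ)) := by
  classical
  refine (gaussianExpectation_const_mul_sum _ _ _ fun _ _ => continuous_expVal_sq _).trans ?_
  congr 1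
  refine (sum_meanSq _ (by simp)).trans (Finset.sum_congr rfl fun k hk => ?_)
  obtain ⟨hk1, m, hm⟩ := Finset.mem_filter.mp hk
  have hk1 := Finset.mem_Icc.mp hk1
  obtain rfl : k = 2 * m := by omega
  have h1 : ((level n (2 * m)).filter fun s => s ≠ 0 ∧
      (pauliString s).transpose = pauliString s) =
      (level n (2 * m)).filter fun s => transposeSign s = 1 := by
    refine Finset.filter_congr fun s hs => ?_
    rw [pauliString_transpose_eq_self_iff, and_iff_right]
    rintro rfl
    rw [mem_level, anticommSet_zero, Finset.card_empty] at hs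
    omega
  rw [h1, (card_level_transposeSign _).1, card_diagLevel_two_mul,
    Nat.mul_div_cancel_left m two_pos, div_mul_div_comm]

lemma gaussianExpectation_lamReal :
    gaussianExpectation (n := n) lamReal = 1 / (2 : ℝ) ^ (n - 1) *
      ∑ k ∈ (Finset.Icc 2 (2 * n)).filter Even,
        (((2 * n).choose k : ℝ) - (n.choose (k / 2) : ℝ)) * (n.choose (k / 2) : ℝ) /
          (2 * ((2 * n).choose k : ℝ)) := by
  classical
  refine (gaussianExpectation_const_mul_sum _ _ _ fun _ _ => continuous_expVal_sq _).trans ?_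
  congr 1
  have h0 : ¬ (pauliString (0 : Fin n → Fin 4)).transpose = -pauliString 0 := by
    rw [pauliString_transpose_eq_neg_iff]
    simp [transposeSign, pauliTransposeSign]
  refine (sum_meanSq _ h0).trans (Finset.sum_congr rfl fun k hk => ?_)
  obtain ⟨-, m, hm⟩ := Finset.mem_filter.mp hk
  obtain rfl : k = 2 * m := by omega
  simp only [pauliString_transpose_eq_neg_iff]
  rw [(card_level_transposeSign _).2, card_diagLevel_two_mul,
    Nat.mul_div_cancel_left m two_pos, div_mul_div_comm]

/-! ### The limits -/

lemma sum_even_Icc (f : ℕ → ℝ) (n : ℕ) :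
    ∑ k ∈ (Finset.Icc 2 (2 * n)).filter Even, f k = ∑ m ∈ Finset.Icc 1 n, f (2 * m) := by
  symm
  refine Finset.sum_nbij' (fun m => 2 * m) (fun k => k / 2) ?_ ?_ ?_ ?_ ?_
  · intro m hm
    rw [Finset.mem_Icc] at hm
    rw [Finset.mem_filter, Finset.mem_Icc]
    exact ⟨by omega, even_two_mul m⟩
  · intro k hk
    rw [Finset.mem_filter, Finset.mem_Icc] at hk
    rw [Finset.mem_Icc]
    omega
  · intro m _
    exact Nat.mul_div_cancel_left m two_pos
  · intro k hk
    exact Nat.mul_div_cancel' (Finset.mem_filter.mp hk).2.two_dvd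
  · exact fun _ _ => rfl

/-- The contribution of the signed counts of the levels to the expectations of the imaginarity and
realness witnesses, up to normalization. -/
noncomputable def remainder (n : ℕ) : ℝ :=
  ∑ m ∈ Finset.Icc 1 n, (n.choose m : ℝ) ^ 2 / ((2 * n).choose (2 * m) : ℝ)

lemma sum_choose_Icc (n : ℕ) : ∑ m ∈ Finset.Icc 1 n, (n.choose m : ℝ) = 2 ^ n - 1 := by
  have h := Nat.sum_range_choose n
  rw [Finset.sum_range_succ', Nat.choose_zero_right] at h
  have h1 : ∑ m ∈ Finset.Icc 1 n, n.choose m = ∑ k ∈ Finset.range n, n.choose (k + 1) := by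
    rw [Finset.range_eq_Ico, Finset.sum_Ico_add' (fun k => n.choose k) 0 n 1]
    rfl
  have h2 : (∑ m ∈ Finset.Icc 1 n, (n.choose m : ℝ)) + 1 = 2 ^ n := by
    rw [← h1] at h
    exact_mod_cast h
  linarith

lemma sum_add_eq (n : ℕ) :
    ∑ k ∈ (Finset.Icc 2 (2 * n)).filter Even,
      (((2 * n).choose k : ℝ) + (n.choose (k / 2) : ℝ)) * (n.choose (k / 2) : ℝ) /
        (2 * ((2 * n).choose k : ℝ)) = (2 ^ n - 1) / 2 + remainder n / 2 := by
  rw [sum_even_Icc, ← sum_choose_Icc, remainder, Finset.sum_div, Finset.sum_div,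
    ← Finset.sum_add_distrib]
  refine Finset.sum_congr rfl fun m hm => ?_
  have h : ((2 * n).choose (2 * m) : ℝ) ≠ 0 := by
    have := (Finset.mem_Icc.mp hm).2
    exact_mod_cast (Nat.choose_pos (by omega : 2 * m ≤ 2 * n)).ne'
  rw [Nat.mul_div_cancel_left m two_pos]
  field_simp

lemma sum_sub_eq (n : ℕ) :
    ∑ k ∈ (Finset.Icc 2 (2 * n)).filter Even,
      (((2 * n).choose k : ℝ) - (n.choose (k / 2) : ℝ)) * (n.choose (k / 2) : ℝ) /
        (2 * ((2 * n).choose k : ℝ)) = (2 ^ n - 1) / 2 - remainder n / 2 := by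
  rw [sum_even_Icc, ← sum_choose_Icc, remainder, Finset.sum_div, Finset.sum_div,
    ← Finset.sum_sub_distrib]
  refine Finset.sum_congr rfl fun m hm => ?_
  have h : ((2 * n).choose (2 * m) : ℝ) ≠ 0 := by
    have := (Finset.mem_Icc.mp hm).2
    exact_mod_cast (Nat.choose_pos (by omega : 2 * m ≤ 2 * n)).ne'
  rw [Nat.mul_div_cancel_left m two_pos]
  field_simp

/-- One term of Vandermonde's identity. -/
lemma choose_sq_le (n m : ℕ) : n.choose m ^ 2 ≤ (2 * n).choose (2 * m) := by
  rw [two_mul n, Nat.add_choose_eq, pow_two]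
  exact Finset.single_le_sum (f := fun q : ℕ × ℕ => n.choose q.1 * n.choose q.2)
    (fun _ _ => Nat.zero_le _) (a := (m, m)) (by simp [two_mul])

lemma remainder_nonneg (n : ℕ) : 0 ≤ remainder n :=
  Finset.sum_nonneg fun _ _ => by positivity

lemma remainder_le (n : ℕ) : remainder n ≤ n := by
  calc remainder n ≤ ∑ m ∈ Finset.Icc 1 n, (1 : ℝ) :=
        Finset.sum_le_sum fun m _ =>
          div_le_one_of_le₀ (by exact_mod_cast choose_sq_le n m) (by positivity)
    _ = n := by simp

lemma tendsto_remainder_div : Tendsto (fun n : ℕ => remainder n / 2 ^ n) atTop (𝓝 0) := by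
  have h := tendsto_pow_const_div_const_pow_of_one_lt 1 (one_lt_two : (1 : ℝ) < 2)
  refine squeeze_zero (fun n => div_nonneg (remainder_nonneg n) (by positivity)) (fun n => ?_) h
  rw [pow_one]
  gcongr
  exact remainder_le n

lemma tendsto_inv_two_pow : Tendsto (fun n : ℕ => 1 / (2 : ℝ) ^ n) atTop (𝓝 0) := by
  simp only [one_div]
  exact tendsto_inv_atTop_zero.comp (tendsto_pow_atTop_atTop_of_one_lt one_lt_two)

lemma tendsto_lamImag :
    Tendsto (fun n : ℕ => gaussianExpectation (n := n) lamImag) atTop (𝓝 (1 / 2)) := by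
  have h : Tendsto (fun n : ℕ => 1 / 2 + (remainder n / 2 ^ n) / 2 / (1 - 1 / (2 : ℝ) ^ n)) atTop
      (𝓝 (1 / 2 + 0 / 2 / (1 - 0))) :=
    ((tendsto_remainder_div.div_const 2).div (tendsto_inv_two_pow.const_sub 1)
      (by norm_num)).const_add _
  simp only [zero_div, add_zero] at h
  refine h.congr' ?_
  filter_upwards [eventually_ge_atTop 1] with n hn
  rw [gaussianExpectation_lamImag, sum_add_eq]
  have h1 : (1 : ℝ) < 2 ^ n := one_lt_pow₀ one_lt_two (by omega)
  have h2 : (2 : ℝ) ^ n - 1 ≠ 0 := by linarith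
  field_simp

lemma tendsto_lamReal :
    Tendsto (fun n : ℕ => gaussianExpectation (n := n) lamReal) atTop (𝓝 1) := by
  have h : Tendsto (fun n : ℕ => 1 - 1 / (2 : ℝ) ^ n - remainder n / 2 ^ n) atTop
      (𝓝 (1 - 0 - 0)) :=
    (tendsto_inv_two_pow.const_sub 1).sub tendsto_remainder_div
  simp only [sub_zero] at h
  refine h.congr' ?_
  filter_upwards [eventually_ge_atTop 1] with n hn
  rw [gaussianExpectation_lamReal, sum_sub_eq]
  obtain ⟨m, rfl⟩ := Nat.exists_eq_add_of_le' hn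
  rw [Nat.add_sub_cancel, pow_succ]
  field_simp

lemma tendsto_one_div_two_mul_sub_one :
    Tendsto (fun n : ℕ => 1 / (2 * (n : ℝ) - 1)) atTop (𝓝 0) := by
  simp only [one_div]
  refine tendsto_inv_atTop_zero.comp (tendsto_atTop_add_const_right _ (-1) ?_)
  exact tendsto_natCast_atTop_atTop.const_mul_atTop two_pos

lemma tendsto_lamEnt :
    Tendsto (fun n : ℕ => gaussianExpectation (n := n) lamEnt) atTop (𝓝 0) := by
  refine tendsto_one_div_two_mul_sub_one.congr' ?_
  filter_upwards [eventually_ge_atTop 1] with n hn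
  exact (gaussianExpectation_lamEnt hn).symm

lemma tendsto_lamUent :
    Tendsto (fun n : ℕ => gaussianExpectation (n := n) lamUent) atTop (𝓝 0) := by
  have h := tendsto_one_div_atTop_nhds_zero_nat (𝕜 := ℝ) |>.mul tendsto_one_div_two_mul_sub_one
  rw [mul_zero] at h
  refine h.congr' ?_
  filter_upwards [eventually_ge_atTop 3] with n hn
  rw [gaussianExpectation_lamUent (by omega) (by omega), one_div_mul_one_div]

end GaussianWitness

open GaussianWitness in
theorem proposition7 :
    (∀ n : ℕ, 1 ≤ n →
      (Integrable (fun U => lamEnt (gaussianState U)) (gaussianHaar n) ∧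
        gaussianExpectation (n := n) lamEnt = 1 / (2 * (n : ℝ) - 1)) ∧
      (Integrable (fun U => lamImag (gaussianState U)) (gaussianHaar n) ∧
        gaussianExpectation (n := n) lamImag =
          1 / ((2 : ℝ) ^ n - 1) *
            ∑ k ∈ (Finset.Icc 2 (2 * n)).filter Even,
              (((2 * n).choose k : ℝ) + (n.choose (k / 2) : ℝ)) * (n.choose (k / 2) : ℝ) /
                (2 * ((2 * n).choose k : ℝ))) ∧
      (Integrable (fun U => lamReal (gaussianState U)) (gaussianHaar n) ∧
        gaussianExpectation (n := n) lamReal =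
          1 / (2 : ℝ) ^ (n - 1) *
            ∑ k ∈ (Finset.Icc 2 (2 * n)).filter Even,
              (((2 * n).choose k : ℝ) - (n.choose (k / 2) : ℝ)) * (n.choose (k / 2) : ℝ) /
                (2 * ((2 * n).choose k : ℝ))) ∧
      (Integrable (fun U => lamUent (gaussianState U)) (gaussianHaar n) ∧
        (n ≠ 2 →
          gaussianExpectation (n := n) lamUent = 1 / ((n : ℝ) * (2 * (n : ℝ) - 1))))) ∧
    Tendsto (fun n : ℕ => gaussianExpectation (n := n) lamEnt) atTop (𝓝 0) ∧
    Tendsto (fun n : ℕ => gaussianExpectation (n := n) lamImag) atTop (𝓝 (1 / 2)) ∧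
    Tendsto (fun n : ℕ => gaussianExpectation (n := n) lamReal) atTop (𝓝 1) ∧
    Tendsto (fun n : ℕ => gaussianExpectation (n := n) lamUent) atTop (𝓝 0) := by
  refine ⟨fun n hn => ⟨⟨integrable_gaussianState continuous_lamEnt, gaussianExpectation_lamEnt hn⟩,
    ⟨integrable_gaussianState continuous_lamImag, gaussianExpectation_lamImag⟩,
    ⟨integrable_gaussianState continuous_lamReal, gaussianExpectation_lamReal⟩,
    ⟨integrable_gaussianState continuous_lamUent, gaussianExpectation_lamUent hn⟩⟩,
    tendsto_lamEnt, tendsto_lamImag, tendsto_lamReal, tendsto_lamUent⟩
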